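/- Setting. Let $S_n$ be the unit sphere in $\mathbb R^n$ and $h(m,n)$ the number of orthonormal spherical harmonics of degree $m$ on it. Let $K$ be a finite or countable index set with $\ell_2=\ell_2(K)$ and standard basis $(e_k)_{k\in K}$. A spectral density is a family $F=(F_m)_{m\ge 0}$ of measurable functions on $[-\pi,\pi)$ whose values are, almost everywhere, positive operators $F_m(\lambda)$ of trace class in $\ell_2$, identified with the matrices $f_m^{kn}=\langle F_m e_k,e_n\rangle$ (so $h^\top F_m\bar h=\langle F_mh,h\rangle$), such that $\int_{-\pi}^{\pi}\mathrm{Tr}\,F_m\,d\lambda<\infty$ for every $m$ and $\sum_m h(m,n)\int_{-\pi}^{\pi}\mathrm{Tr}\,F_m\,d\lambda<\infty$. Such $F$ and $G$ are the spectral densities of the component sequences $\vec\zeta_m^l(j)$ and $\vec\theta_m^l(j)$ ($m\ge0$, $1\le l\le h(m,n)$, $j\in\mathbb Z$) of two uncorrelated periodically correlated isotropic random fields $\zeta$ (signal) and $\theta$ (noise) on $S_n$. Let $\vec a_m^l(j)\in\ell_2$, $j\ge 0$, satisfy $\sum_{m,l,j}\|\vec a_m^l(j)\|<\infty$ and $\sum_{m,l,j}(j+1)\|\vec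 a_m^l(j)\|^2<\infty$, put $A_m^l(\lambda)=\sum_{j\ge0}\vec a_m^l(j)e^{ij\lambda}$, and consider the functional $A\zeta=\sum_{m,l}\sum_{j\ge 0}\vec a_m^l(j)^\top\vec\zeta_m^l(j)$, to be estimated linearly from $\vec\zeta_m^l(j)+\vec\theta_m^l(j)$, $j<0$. $L_2(F)$ is the space of vector functions $h=(h_m^l)$ with $\sum_{m,l}\int_{-\pi}^{\pi}(h_m^l)^\top F_m\overline{h_m^l}\,d\lambda<\infty$, and $L_2^-(F)$ is its closed subspace generated by the functions $e^{ij\lambda}e_k$, $j<0$, $k\in K$, in each component $(m,l)$. The mean square error of the linear estimate with spectral characteristic $h$ is $$\Delta(h;F,G)=\sum_{m,l}\frac1{2\pi}\int_{-\pi}^{\pi}\Big[(A_m^l-h_m^l)^\top F_m\overline{(A_m^l-h_m^l)}+(h_m^l)^\top G_m\overline{h_m^l}\Big]d\lambda ,$$ that of the optimal estimate is $\Delta(F,G)=\inf_{h\in L_2^-(F+G)}\Delta(h;F,G)$, and a minimizer is denoted by $h(F,G)$. Given classes $D_F,D_G$ of spectral densities, $F^0\in D_F$ and $G^0\in D_G$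 are called least favorable in $D=D_F\times D_G$ if $h(F^0,G^0)$ exists and $\Delta(F^0,G^0)=\Delta(h(F^0,G^0);F^0,G^0)=\max_{(F,G)\in D}\Delta(F,G)$. The pair $(F,G)$ satisfies the minimality condition if, for every $m$, $F_m+G_m$ is invertible almost everywhere and $\int_{-\pi}^{\pi}\mathrm{Tr}[(F_m+G_m)^{-1}]\,d\lambda<\infty$. For such a pair let $\mathbf B_m,\mathbf D_m,\mathbf R_m$ be the block matrices whose blocks in row $s$ and column $j$ ($s,j\ge0$) are $\frac1{2\pi}\int_{-\pi}^{\pi}X^\top(\lambda)e^{i(j-s)\lambda}d\lambda$ with $X=(F_m+G_m)^{-1}$, $X=F_m(F_m+G_m)^{-1}$, $X=F_m(F_m+G_m)^{-1}G_m$ (matrix products), respectively; let $\mathbf a_m^l=(\vec a_m^l(j))_{j\ge0}$. Here $\langle\mathbf B_m^{-1}d,d\rangle$ is the value at $d$ of the quadratic form inverse to $\mathbf B_m$, that is $\sup_x(2\,\mathrm{Re}\langle d,x\rangle-\langle\mathbf B_mx,x\rangle)$ over finitely supported $x$, which is the usual $\langle\mathbf B_m^{-1}d,d\rangle$ when $\mathbf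 B_m$ is a bounded invertible operator in $\ell_2$. Lemma. Suppose that every pair in $D$ satisfies the minimality condition, or that $D_F$ and $D_G$ are convex. Let $F^0\in D_F$, $G^0\in D_G$ satisfy the minimality condition, and suppose that their matrices $\mathbf B^0_m,\mathbf D^0_m,\mathbf R^0_m$ give a solution of the constrained optimization problem $$\sup_{(F,G)}\ \sum_{m=0}^\infty\sum_{l=1}^{h(m,n)}\Big(\langle\mathbf a_m^l,\mathbf R_m\mathbf a_m^l\rangle+\langle\mathbf B_m^{-1}\mathbf D_m\mathbf a_m^l,\mathbf D_m\mathbf a_m^l\rangle\Big)=\sum_{m=0}^\infty\sum_{l=1}^{h(m,n)}\Big(\langle\mathbf a_m^l,\mathbf R^0_m\mathbf a_m^l\rangle+\langle(\mathbf B^0_m)^{-1}\mathbf D^0_m\mathbf a_m^l,\mathbf D^0_m\mathbf a_m^l\rangle\Big),$$ the supremum being over the pairs $(F,G)\in D$ that satisfy the minimality condition (those for which the matrices are defined). Then $F^0,G^0$ are least favorable in $D$ for the optimal linear estimation of $A\zeta$. -/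

import Mathlib

open MeasureTheory Set
open scoped ENNReal

noncomputable section

namespace Extrapolation

/-- The Laplace operator on real polynomials in `n` variables. -/
def laplacian (n : ℕ) : MvPolynomial (Fin n) ℝ →ₗ[ℝ] MvPolynomial (Fin n) ℝ :=
  ∑ i : Fin n, (MvPolynomial.pderiv i).toLinearMap ∘ₗ (MvPolynomial.pderiv i).toLinearMap

/-- The number `h(m,n)` of orthonormal spherical harmonics of degree `m` on the unit sphere of
`ℝⁿ`: the dimension of the space of harmonic homogeneous polynomials of degree `m`. -/
def harmonicCount (m n : ℕ) : ℕ :=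
  Module.finrank ℝ
    ↥(MvPolynomial.homogeneousSubmodule (Fin n) ℝ m ⊓ LinearMap.ker (laplacian n))

/-- The pairs `(m, l)` with `m = 0, 1, …` and `l` one of `h(m,n)` indices. -/
abbrev HIndex (n : ℕ) : Type := Σ m : ℕ, Fin (harmonicCount m n)

/-- The space `ℓ₂` of square summable families indexed by the set `K` of components. -/
abbrev Ell (K : Type*) : Type _ := lp (fun _ : K => ℂ) 2

/-- Families `(F_m)_{m ≥ 0}` of operator-valued functions on the frequency axis. -/
abbrev OpFamily (K : Type*) : Type _ := ℕ → ℝ → (Ell K →L[ℂ] Ell K)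

/-- Lebesgue measure on `[-π, π)`. -/
abbrev circ : Measure ℝ := volume.restrict (Ico (-Real.pi) Real.pi)

/-- The standard basis vector `e_k` of `ℓ₂`. -/
def basisVec {K : Type*} (k : K) : Ell K := by
  classical exact lp.single 2 k (1 : ℂ)

/-- Trace of a positive operator. -/
def posTrace {K : Type*} (X : Ell K →L[ℂ] Ell K) : ℝ≥0∞ :=
  ∑' k : K, ENNReal.ofReal (inner ℂ (basisVec k) (X (basisVec k))).re

/-- Spectral densities of a field on the sphere of `ℝⁿ`: measurable, almost everywhere positive
kernel operators with integrable trace, the total power `∑_m h(m,n) ∫ Tr F_m` being finite.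
The entries of the matrix `F_m(s)` are `f_m^{kn}(s) = ⟨F_m(s) e_k, e_n⟩`, so that
`hᵀ F_m(s) h̄ = ⟨F_m(s) h, h⟩`. -/
structure IsSpectralDensity (n : ℕ) {K : Type*} (F : OpFamily K) : Prop where
  measurable_entries : ∀ m (k k' : K),
    AEStronglyMeasurable (fun s => inner ℂ (basisVec k') (F m s (basisVec k))) circ
  positive : ∀ m, ∀ᵐ s ∂circ, (F m s).IsPositive
  trace_integrable : ∀ m, ∫⁻ s, posTrace (F m s) ∂circ ≠ ⊤
  total_power : ∑' m : ℕ, (harmonicCount m n : ℝ≥0∞) * ∫⁻ s, posTrace (F m s) ∂circ ≠ ⊤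

/-- The minimality condition: for every `m` the operators `F_m + G_m` are invertible almost
everywhere and the trace of the inverse is integrable. -/
def Minimality {K : Type*} (F G : OpFamily K) : Prop :=
  ∀ m, (∀ᵐ s ∂circ, IsUnit (F m s + G m s)) ∧
    ∫⁻ s, posTrace (Ring.inverse (F m s + G m s)) ∂circ ≠ ⊤

/-- The summability conditions on the coefficients `a_m^l(j)` of the functional. -/
structure IsAdmissibleCoeff {n : ℕ} {K : Type*} (a : HIndex n → ℕ → Ell K) : Prop where
  summable_norm : Summable fun p : HIndex n × ℕ => ‖a p.1 p.2‖
  summable_sq : Summable fun p : HIndex n × ℕ => ((p.2 : ℝ) + 1) * ‖a p.1 p.2‖ ^ 2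

/-- `A_m^l(s) = ∑_{j ≥ 0} a_m^l(j) e^{ijs}`. -/
def symbolA {n : ℕ} {K : Type*} (a : HIndex n → ℕ → Ell K) (i : HIndex n) (s : ℝ) : Ell K :=
  ∑' j : ℕ, Complex.exp (Complex.I * (j : ℂ) * (s : ℂ)) • a i j

/-! The spaces `L₂(F)` and `L₂⁻(F)` and the mean square error. -/

/-- The squared (semi)norm `∑_{m,l} ∫ (h_m^l)ᵀ F_m conj(h_m^l) ds` of `L₂(F)`. -/
def sqNorm {n : ℕ} {K : Type*} (F : OpFamily K) (h : HIndex n → ℝ → Ell K) : ℝ≥0∞ :=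
  ∑' i : HIndex n, ∫⁻ s, ENNReal.ofReal (inner ℂ (h i s) (F i.1 s (h i s))).re ∂circ

/-- The space `L₂(F)`. -/
def L2 (n : ℕ) {K : Type*} (F : OpFamily K) : Set (HIndex n → ℝ → Ell K) :=
  {h | (∀ i, AEStronglyMeasurable (h i) circ) ∧ sqNorm F h ≠ ⊤}

/-- The linear span of the functions `e^{ijs} δ_k`, `j < 0`, placed in any component `(m, l)`. -/
def negPoly (n : ℕ) (K : Type*) : Submodule ℂ (HIndex n → ℝ → Ell K) :=
  Submodule.span ℂ {g | ∃ (i : HIndex n) (j : ℤ) (k : K), j < 0 ∧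
    g = Pi.single i (fun s : ℝ => Complex.exp (Complex.I * (j : ℂ) * (s : ℂ)) • basisVec k)}

/-- `L₂⁻(F)`: the closed subspace of `L₂(F)` generated by these functions. -/
def L2neg (n : ℕ) {K : Type*} (F : OpFamily K) : Set (HIndex n → ℝ → Ell K) :=
  {h | h ∈ L2 n F ∧ ∀ ε : ℝ≥0∞, 0 < ε → ∃ p ∈ negPoly n K, sqNorm F (h - p) < ε}

/-- The mean square error `Δ(h; F, G)` of the linear estimate with spectral characteristic `h`. -/
def mse {n : ℕ} {K : Type*} (a : HIndex n → ℕ → Ell K) (h : HIndex n → ℝ → Ell K)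
    (F G : OpFamily K) : ℝ≥0∞ :=
  ∑' i : HIndex n, ENNReal.ofReal (1 / (2 * Real.pi)) * ∫⁻ s,
    (ENNReal.ofReal
        (inner ℂ (symbolA a i s - h i s) (F i.1 s (symbolA a i s - h i s))).re
      + ENNReal.ofReal (inner ℂ (h i s) (G i.1 s (h i s))).re) ∂circ

/-- The mean square error `Δ(F, G)` of the optimal linear estimate. -/
def optMse {n : ℕ} {K : Type*} (a : HIndex n → ℕ → Ell K) (F G : OpFamily K) : ℝ≥0∞ :=
  ⨅ h ∈ L2neg n (F + G), mse a h F G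

/-- `h = h(F, G)` is a spectral characteristic of the optimal linear estimate. -/
def IsOptimal {n : ℕ} {K : Type*} (a : HIndex n → ℕ → Ell K) (h : HIndex n → ℝ → Ell K)
    (F G : OpFamily K) : Prop :=
  h ∈ L2neg n (F + G) ∧ mse a h F G = optMse a F G

/-- `(F⁰, G⁰)` is least favorable in `D_F × D_G`:
`Δ(F⁰, G⁰) = Δ(h(F⁰, G⁰); F⁰, G⁰)` is the maximum of `Δ(F, G)` over `D_F × D_G`. -/
def IsLeastFavorable {n : ℕ} {K : Type*} (a : HIndex n → ℕ → Ell K) (DF DG : Set (OpFamily K))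
    (F₀ G₀ : OpFamily K) : Prop :=
  F₀ ∈ DF ∧ G₀ ∈ DG ∧ (∃ h₀, IsOptimal a h₀ F₀ G₀) ∧
    ∀ F ∈ DF, ∀ G ∈ DG, optMse a F G ≤ optMse a F₀ G₀

/-! The block Toeplitz matrices and the objective functional. -/

/-- The `(k', k)` entry of the Fourier coefficient `(1/2π) ∫ X(s) e^{ips} ds` of an
operator-valued function. -/
def fourierEntry {K : Type*} (X : ℝ → (Ell K →L[ℂ] Ell K)) (p : ℤ) (k' k : K) : ℂ :=
  1 / (2 * (Real.pi : ℂ)) * ∫ s in (-Real.pi)..Real.pi,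
    Complex.exp (Complex.I * (p : ℂ) * (s : ℂ)) * inner ℂ (basisVec k') (X s (basisVec k))

/-- The block matrix whose block in row `s` and column `j` is `(1/2π) ∫ X(t) e^{i(j-s)t} dt`. -/
def toeplitz {K : Type*} (X : ℝ → (Ell K →L[ℂ] Ell K)) : Matrix (ℕ × K) (ℕ × K) ℂ :=
  fun q p => fourierEntry X ((p.1 : ℤ) - (q.1 : ℤ)) q.2 p.2

/-- The matrix `B_m`. -/
def matB {K : Type*} (F G : OpFamily K) (m : ℕ) : Matrix (ℕ × K) (ℕ × K) ℂ :=
  toeplitz fun s => Ring.inverse (F m s + G m s)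

/-- The matrix `D_m`. The operator with matrix `[F (F+G)⁻¹]ᵀ` is `(F+G)⁻¹ ∘ F`, because the
operator `F` acts on columns by the transpose of the matrix `⟨F e_k, e_n⟩`. -/
def matD {K : Type*} (F G : OpFamily K) (m : ℕ) : Matrix (ℕ × K) (ℕ × K) ℂ :=
  toeplitz fun s => Ring.inverse (F m s + G m s) * F m s

/-- The matrix `R_m`. The operator with matrix `[F (F+G)⁻¹ G]ᵀ` is `G ∘ (F+G)⁻¹ ∘ F`. -/
def matR {K : Type*} (F G : OpFamily K) (m : ℕ) : Matrix (ℕ × K) (ℕ × K) ℂ :=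
  toeplitz fun s => G m s * Ring.inverse (F m s + G m s) * F m s

/-- The action of an infinite matrix on a sequence. -/
def matAct {ι : Type*} (M : Matrix ι ι ℂ) (x : ι → ℂ) : ι → ℂ :=
  fun q => ∑' p, M q p * x p

/-- The pairing `⟨x, y⟩ = ∑ x_p conj(y_p)`. -/
def pairing {ι : Type*} (x y : ι → ℂ) : ℂ :=
  ∑' p, x p * (starRingEnd ℂ) (y p)

/-- The value `⟨B⁻¹ d, d⟩` of the quadratic form inverse to a positive matrix `B`, defined
by the variational formula `sup_x (2 Re ⟨d, x⟩ - ⟨B x, x⟩)` over finitely supported `x`.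
It makes sense also when `B` does not define a bounded invertible operator in `ℓ₂`;
when it does, `invForm_eq` below shows that this is literally `⟨B⁻¹ d, d⟩`. -/
def invForm {ι : Type*} (B : Matrix ι ι ℂ) (d : ι → ℂ) : ℝ≥0∞ :=
  ⨆ x : ι →₀ ℂ, ENNReal.ofReal (2 * (pairing d x).re - (pairing (matAct B x) x).re)

/-- The coordinates of a vector are its inner products with the basis. -/
theorem inner_basisVec {ι : Type*} (q : ι) (y : Ell ι) : inner ℂ (basisVec q) y = y q := by
  classical
  have h := lp.inner_single_left (𝕜 := ℂ) q (1 : ℂ) y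
  simp only [basisVec]
  convert h using 1
  simp

/-- If `B` is the matrix of a bounded positive operator `T` of `ℓ₂` with bounded inverse, then
`invForm B d` is the number `⟨T⁻¹ d, d⟩`. -/
theorem invForm_eq {ι : Type*} (B : Matrix ι ι ℂ) (T : Ell ι ≃L[ℂ] Ell ι)
    (hT : (T : Ell ι →L[ℂ] Ell ι).IsPositive)
    (hB : ∀ q p, B q p = inner ℂ (basisVec q) (T (basisVec p))) (d : Ell ι) :
    invForm B d = ENNReal.ofReal (inner ℂ d (T.symm d)).re := by
  classical
  have hpair : ∀ y x : Ell ι, pairing y x = inner ℂ x y := by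
    intro y x
    rw [lp.inner_eq_tsum]
    simp [pairing]
  let vec : (ι →₀ ℂ) → Ell ι := fun x => ∑ p ∈ x.support, x p • basisVec p
  have hvec : ∀ x : ι →₀ ℂ, ((vec x : Ell ι) : ι → ℂ) = x := by
    intro x
    funext q
    rw [← inner_basisVec, inner_sum]
    simp only [inner_smul_right, inner_basisVec]
    have : ∀ p, (basisVec p : Ell ι) q = if p = q then 1 else 0 := by
      intro p
      by_cases hpq : p = q
      · subst hpq; simp [basisVec]
      · simp [basisVec, hpq, Ne.symm hpq]
    simp [this]
    exact fun h => h.symm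
  have hact : ∀ x : ι →₀ ℂ, matAct B x = ((T (vec x) : Ell ι) : ι → ℂ) := by
    intro x
    funext q
    rw [← inner_basisVec, matAct, tsum_eq_sum (s := x.support)]
    · simp [vec, map_sum, hB, mul_comm]
    · intro p hp
      simp [Finsupp.notMem_support_iff.mp hp]
  let f : Ell ι → ℝ := fun x => 2 * (inner ℂ x d).re - (inner ℂ x (T x)).re
  have hinv : invForm B d = ⨆ x : ι →₀ ℂ, ENNReal.ofReal (f (vec x)) := by
    unfold invForm
    congr 1
    funext x
    rw [hact, ← hvec x, hpair, hpair]
  have hsa : ∀ x y : Ell ι, inner ℂ (T x) y = inner ℂ x (T y) := fun x y => hT.isSymmetric x y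
  have hf : ∀ x, f x ≤ (inner ℂ d (T.symm d)).re := by
    intro x
    have h0 := hT.re_inner_nonneg_right (x - T.symm d)
    have h1 : inner ℂ (T.symm d) (T x) = inner ℂ d x := by rw [← hsa]; simp
    have h2 : (inner ℂ d x).re = (inner ℂ x d).re := by
      exact inner_re_symm (𝕜 := ℂ) d x
    have h3 : (inner ℂ (T.symm d) d).re = (inner ℂ d (T.symm d)).re := by
      exact inner_re_symm (𝕜 := ℂ) _ _
    simp only [ContinuousLinearEquiv.coe_coe, map_sub, ContinuousLinearEquiv.apply_symm_apply,
      inner_sub_left, inner_sub_right, h1, RCLike.re_to_complex, h2, h3] at h0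
    simp only [f]
    linarith
  have hfz : f (T.symm d) = (inner ℂ d (T.symm d)).re := by
    have h3 : (inner ℂ (T.symm d) d).re = (inner ℂ d (T.symm d)).re := by
      exact inner_re_symm (𝕜 := ℂ) _ _
    simp only [f, ContinuousLinearEquiv.apply_symm_apply, h3]
    ring
  have hcont : Continuous f := by fun_prop
  rw [hinv]
  apply le_antisymm
  · exact iSup_le fun x => ENNReal.ofReal_le_ofReal (hf _)
  · rw [← hfz]
    have hs := lp.hasSum_single (E := fun _ : ι => ℂ) (p := 2) (by simp) (T.symm d)
    have ht := (ENNReal.continuous_ofReal.comp hcont).continuousAt.tendsto.comp hs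
    refine le_of_tendsto' ht fun t => ?_
    let x : ι →₀ ℂ := ∑ i ∈ t, Finsupp.single i ((T.symm d : Ell ι) i)
    refine le_trans (le_of_eq ?_) (le_iSup _ x)
    simp only [Function.comp]
    congr 2
    apply lp.ext
    rw [hvec]
    funext q
    rw [lp.coeFn_sum, Finset.sum_apply]
    simp only [x, Finsupp.finsetSum_apply]
    refine Finset.sum_congr rfl fun i _ => ?_
    simp [Finsupp.single_apply, Pi.single_apply, eq_comm]

/-- The sequence `𝐚_m^l` with all its coordinates. -/
def vecA {n : ℕ} {K : Type*} (a : HIndex n → ℕ → Ell K) (i : HIndex n) : ℕ × K → ℂ :=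
  fun p => a i p.1 p.2

/-- The functional `∑_{m,l} (⟨a, R_m a⟩ + ⟨B_m⁻¹ D_m a, D_m a⟩)`, with `a = 𝐚_m^l`. -/
def objective {n : ℕ} {K : Type*} (a : HIndex n → ℕ → Ell K) (F G : OpFamily K) : ℝ≥0∞ :=
  ∑' i : HIndex n,
    (ENNReal.ofReal (pairing (vecA a i) (matAct (matR F G i.1) (vecA a i))).re
      + invForm (matB F G i.1) (matAct (matD F G i.1) (vecA a i)))


end Extrapolation

end

/-! Under the minimality condition the minimal mean square error equals the objective functional
(`optMse_eq_objective`). On the minimal pairs the maximality hypothesis is therefore already the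
conclusion, and a convexity argument covers the other pairs.

Minimality forces `K` to be finite, since an operator and its inverse cannot both have finite trace
in infinite dimension. Write F + G = T² with T positive and S = T⁻¹; the trace conditions put T and
S in L². Completing the square at a fixed frequency gives the error as ‖T h - S F A‖² + ⟨A, G
(F+G)⁻¹ F A⟩. The second term integrates to the form of R. The first is minimized by projecting U =
S F A onto the past N, the closed span of T e^{ijs} e_k with j < 0. The squared distance of U to N
is the supremum of 2 Re⟨z, U⟩ - ‖z‖² over any dense subspace of Nᗮ. On the span of S e^{ijs} e_k
with j ≥ 0 the Gram matrix is 2π B and the products with U are 2π D a, so this supremum is, up to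
the factor 2π, the value of ⟨B⁻¹ D a, D a⟩.

The crux is that this span is dense in Nᗮ (`IsFactorPair.orthogonal_pastSpace`). If v in Nᗮ is
orthogonal to it, the coordinates of T v are analytic, the conjugate coordinates of S v are analytic
with zero mean, and ‖v‖² = ⟨S v, T v⟩. The integral of such a product vanishes for L² factors, but
these factors are only integrable. An analytic multiplier p from an extremal problem of Szegő makes
them square integrable; p is then sent to 1.

For a pair (F, G) that need not be minimal, the mixture t (F, G) + (1 - t) (F₀, G₀) with 0 < t < 1
is minimal and its error is at least t Δ(F, G); let t tend to 1. -/

namespace Extrapolation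

open Filter Topology ComplexConjugate

/-! ### Exponentials and the uniqueness theorem for Fourier coefficients -/

/-- The exponential `s ↦ e^{ijs}`. -/
noncomputable def expo (j : ℤ) (s : ℝ) : ℂ := Complex.exp (Complex.I * (j : ℂ) * (s : ℂ))

theorem expo_zero (s : ℝ) : expo 0 s = 1 := by simp [expo]

theorem expo_add (i j : ℤ) (s : ℝ) : expo (i + j) s = expo i s * expo j s := by
  simp only [expo, ← Complex.exp_add]
  push_cast
  ring_nf

theorem norm_expo (j : ℤ) (s : ℝ) : ‖expo j s‖ = 1 := by
  have : Complex.I * (j : ℂ) * (s : ℂ) = ((j * s : ℝ) : ℂ) * Complex.I := by push_cast; ring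
  rw [expo, this, Complex.norm_exp_ofReal_mul_I]

theorem conj_expo (j : ℤ) (s : ℝ) : conj (expo j s) = expo (-j) s := by
  simp [expo, ← Complex.exp_conj]

theorem continuous_expo (j : ℤ) : Continuous (expo j) := by
  unfold expo
  fun_prop

theorem aestronglyMeasurable_expo (j : ℤ) : AEStronglyMeasurable (expo j) circ :=
  (continuous_expo j).aestronglyMeasurable

theorem circ_univ : circ univ = ENNReal.ofReal (2 * Real.pi) := by
  rw [circ, Measure.restrict_apply_univ, Real.volume_Ico]
  ring_nf

theorem measureReal_circ_univ : circ.real univ = 2 * Real.pi := by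
  rw [measureReal_def, circ_univ, ENNReal.toReal_ofReal Real.two_pi_pos.le]

theorem Integrable.expo_mul {f : ℝ → ℂ} (hf : Integrable f circ) (j : ℤ) :
    Integrable (fun s => expo j s * f s) circ :=
  hf.bdd_mul (aestronglyMeasurable_expo j) (Eventually.of_forall fun s => (norm_expo j s).le)

theorem fourier_coe_eq_expo (j : ℤ) (s : ℝ) :
    fourier j (s : AddCircle (2 * Real.pi)) = expo j s := by
  rw [fourier_coe_apply, expo]
  congr 1
  have : (Real.pi : ℂ) ≠ 0 := by exact_mod_cast Real.pi_ne_zero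
  push_cast
  field_simp

/-- An integrable function whose Fourier coefficients all vanish is zero. -/
theorem ae_eq_zero_of_forall_integral_expo_mul {f : ℝ → ℂ} (hf : Integrable f circ)
    (h : ∀ j : ℤ, ∫ s, expo j s * f s ∂circ = 0) : f =ᵐ[circ] 0 := by
  have : Fact (0 < 2 * Real.pi) := ⟨Real.two_pi_pos⟩
  have hint : ∀ φ : C(AddCircle (2 * Real.pi), ℂ),
      Integrable (fun s : ℝ => φ (s : AddCircle (2 * Real.pi)) * f s) circ := fun φ =>
    hf.bdd_mul (c := ‖φ‖) (by
      apply Continuous.aestronglyMeasurable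
      exact φ.continuous.comp (AddCircle.continuous_mk' _))
      (Eventually.of_forall fun s => φ.norm_coe_le_norm _)
  let L : C(AddCircle (2 * Real.pi), ℂ) →L[ℂ] ℂ := LinearMap.mkContinuous
    { toFun := fun φ => ∫ s, φ (s : AddCircle (2 * Real.pi)) * f s ∂circ
      map_add' := fun φ ψ => by
        simp only [ContinuousMap.add_apply, add_mul]
        exact integral_add (hint φ) (hint ψ)
      map_smul' := fun c φ => by
        simp only [ContinuousMap.smul_apply, smul_eq_mul, mul_assoc, RingHom.id_apply]
        exact integral_const_mul c _ } (∫ s, ‖f s‖ ∂circ) (fun φ => by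
        refine (norm_integral_le_integral_norm _).trans ?_
        rw [mul_comm (∫ s, ‖f s‖ ∂circ), ← integral_const_mul]
        refine integral_mono (hint φ).norm (hf.norm.const_mul _) fun s => ?_
        simp only [norm_mul]
        gcongr
        exact φ.norm_coe_le_norm _)
  have hL : ∀ φ, L φ = ∫ s, φ (s : AddCircle (2 * Real.pi)) * f s ∂circ := fun φ => rfl
  -- Trigonometric polynomials are uniformly dense on the circle and `L` is bounded, so vanishing on
  -- the exponentials kills `L`.
  have hker : (⊤ : Submodule ℂ C(AddCircle (2 * Real.pi), ℂ)) ≤ LinearMap.ker L.toLinearMap := by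
    rw [← span_fourier_closure_eq_top]
    refine Submodule.topologicalClosure_minimal _ ?_ L.isClosed_ker
    rw [Submodule.span_le]
    rintro _ ⟨j, rfl⟩
    change L (fourier j) = 0
    rw [hL]
    simpa only [fourier_coe_eq_expo] using h j
  have hfI : IntegrableOn f (Ioo (-Real.pi) Real.pi) :=
    IntegrableOn.mono_set (show IntegrableOn f (Ico (-Real.pi) Real.pi) volume from hf) Ioo_subset_Ico_self
  have hz := isOpen_Ioo.ae_eq_zero_of_integral_contDiff_smul_eq_zero (μ := volume) (f := f)
    hfI.locallyIntegrableOn (fun g hg _ hsupp => by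
      have hout : ∀ s, s ∉ Ioo (-Real.pi) Real.pi → g s = 0 := fun s hs =>
        image_eq_zero_of_notMem_tsupport fun hs' => hs (hsupp hs')
      -- Both endpoints lie outside the support of `g`, so the test function wraps to a continuous
      -- function on the circle.
      have hend : (fun s => ((g s : ℝ) : ℂ)) (-Real.pi)
          = (fun s => ((g s : ℝ) : ℂ)) (-Real.pi + 2 * Real.pi) := by
        simp only
        rw [hout _ (by simp), hout _ (by simp only [mem_Ioo, not_and, not_lt]; intro; linarith)]
      let φ : C(AddCircle (2 * Real.pi), ℂ) :=
        ⟨AddCircle.liftIco (2 * Real.pi) (-Real.pi) (fun s => ((g s : ℝ) : ℂ)),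
          AddCircle.liftIco_continuous hend
            (Complex.continuous_ofReal.comp hg.continuous).continuousOn⟩
      have hφ : L φ = 0 := hker trivial
      rw [hL] at hφ
      rw [← setIntegral_eq_integral_of_forall_compl_eq_zero (s := Ico (-Real.pi) Real.pi), ← hφ]
      · refine setIntegral_congr_fun measurableSet_Ico fun s hs => ?_
        have : φ (s : AddCircle (2 * Real.pi)) = ((g s : ℝ) : ℂ) :=
          AddCircle.liftIco_coe_apply (f := fun s => ((g s : ℝ) : ℂ))
            ⟨hs.1, by linarith [hs.2]⟩
        simp [this]
      · intro s hs
        rw [hout s fun h' => hs (Ioo_subset_Ico_self h'), zero_smul])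
  rw [Filter.EventuallyEq, circ, ae_restrict_iff' measurableSet_Ico]
  have hne : ∀ᵐ s : ℝ, s ≠ -Real.pi := by
    rw [ae_iff]; simp
  filter_upwards [hz, hne] with s hs hs' hs''
  exact hs ⟨lt_of_le_of_ne hs''.1 (Ne.symm hs'), hs''.2⟩

theorem integral_expo (j : ℤ) : ∫ s, expo j s ∂circ = if j = 0 then 2 * (Real.pi : ℂ) else 0 := by
  split_ifs with hj
  · subst hj
    simp only [expo_zero, integral_const, measureReal_circ_univ]
    simp
  · have hc : Complex.I * (j : ℂ) ≠ 0 := by simp [hj]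
    rw [circ, integral_Ico_eq_integral_Ioo, ← integral_Ioc_eq_integral_Ioo,
      ← intervalIntegral.integral_of_le (by linarith [Real.pi_pos])]
    unfold expo
    rw [integral_exp_mul_complex hc]
    have : Complex.exp (Complex.I * (j : ℂ) * ((Real.pi : ℝ) : ℂ))
        = Complex.exp (Complex.I * (j : ℂ) * ((-Real.pi : ℝ) : ℂ)) := by
      rw [Complex.exp_eq_exp_iff_exists_int]
      exact ⟨j, by push_cast; ring⟩
    rw [this, sub_self, zero_div]

/-- An integrable function whose Fourier coefficients of nonzero index vanish is constant. -/
theorem ae_eq_const_of_integral_expo_mul {f : ℝ → ℂ} (hf : Integrable f circ)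
    (h : ∀ j : ℤ, j ≠ 0 → ∫ s, expo j s * f s ∂circ = 0) :
    ∀ᵐ s ∂circ, f s = (2 * (Real.pi : ℂ))⁻¹ * ∫ t, f t ∂circ := by
  have hpi : (Real.pi : ℂ) ≠ 0 := by exact_mod_cast Real.pi_ne_zero
  set c : ℂ := (2 * (Real.pi : ℂ))⁻¹ * ∫ t, f t ∂circ with hc
  have hfc : Integrable (fun s => f s - c) circ := hf.sub (integrable_const c)
  have := ae_eq_zero_of_forall_integral_expo_mul hfc fun j => by
    simp only [mul_sub]
    rw [integral_sub (Integrable.expo_mul hf j) (Integrable.expo_mul (integrable_const c) j),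
      integral_mul_const, integral_expo]
    split_ifs with hj
    · subst hj
      simp only [expo_zero, one_mul, hc]
      field_simp
      ring
    · simp [h j hj]
  filter_upwards [this] with s hs
  simpa [sub_eq_zero] using hs

theorem memLp_expo (j : ℤ) : MemLp (expo j) 2 circ :=
  MemLp.of_bound (aestronglyMeasurable_expo j) 1 (Eventually.of_forall fun s => (norm_expo j s).le)

/-- If `φ` and `ψ` are square integrable, `∫ φ e^{ijs} = 0` for `j ≥ 0` and `∫ ψ e^{ijs} = 0` for
`j ≥ 1`, then `∫ φ ψ = 0`. -/
theorem integral_mul_eq_zero_of_analytic {φ ψ : ℝ → ℂ} (hφ : MemLp φ 2 circ) (hψ : MemLp ψ 2 circ)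
    (h0 : ∀ j : ℤ, 0 ≤ j → ∫ s, expo j s * φ s ∂circ = 0)
    (h1 : ∀ j : ℤ, 1 ≤ j → ∫ s, expo j s * ψ s ∂circ = 0) : ∫ s, φ s * ψ s ∂circ = 0 := by
  have hinner : ∀ {f g : ℝ → ℂ} (hf : MemLp f 2 circ) (hg : MemLp g 2 circ),
      inner ℂ (hf.toLp f) (hg.toLp g) = ∫ s, conj (f s) * g s ∂circ := by
    intro f g hf hg
    rw [L2.inner_def]
    refine integral_congr_ae ?_
    filter_upwards [hf.coeFn_toLp, hg.coeFn_toLp] with s h1 h2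
    rw [h1, h2, RCLike.inner_apply, mul_comm]
  have hpi : (0 : ℝ) < 2 * Real.pi := Real.two_pi_pos
  have hce : ∀ j : ℤ, MemLp (fun s => ((√(2 * Real.pi))⁻¹ : ℂ) * expo j s) 2 circ :=
    fun j => (memLp_expo j).const_mul _
  let v : ℤ → Lp ℂ 2 circ := fun j => (hce j).toLp _
  have hsq : (√(2 * Real.pi) : ℂ) * √(2 * Real.pi) = 2 * Real.pi := by
    norm_cast
    rw [Real.mul_self_sqrt hpi.le]
  have hsq0 : (√(2 * Real.pi) : ℂ) ≠ 0 := by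
    exact_mod_cast (Real.sqrt_pos.mpr hpi).ne'
  have hv : Orthonormal ℂ v := by
    rw [orthonormal_iff_ite]
    intro i j
    rw [hinner]
    have : ∀ s, conj (((√(2 * Real.pi))⁻¹ : ℂ) * expo i s) * (((√(2 * Real.pi))⁻¹ : ℂ) * expo j s)
        = (2 * (Real.pi : ℂ))⁻¹ * expo (-i + j) s := by
      intro s
      rw [map_mul, conj_expo, expo_add, map_inv₀, Complex.conj_ofReal, ← hsq, mul_inv]
      ring
    simp only [this]
    rw [integral_const_mul, integral_expo]
    by_cases hij : i = j
    · subst hij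
      have : (Real.pi : ℂ) ≠ 0 := by exact_mod_cast Real.pi_ne_zero
      rw [neg_add_cancel, if_pos rfl, if_pos rfl]
      field_simp
    · rw [if_neg hij, if_neg (by omega), mul_zero]
  -- Completeness of the exponentials is the uniqueness theorem applied to an L² function, which is
  -- integrable on a finite measure space.
  have hbot : (Submodule.span ℂ (Set.range v))ᗮ = ⊥ := by
    rw [Submodule.eq_bot_iff]
    intro f hf
    have hfL : MemLp (f : ℝ → ℂ) 2 circ := Lp.memLp f
    have hff : f = hfL.toLp (f : ℝ → ℂ) := (Lp.toLp_coeFn f hfL).symm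
    have : (f : ℝ → ℂ) =ᵐ[circ] 0 := by
      refine ae_eq_zero_of_forall_integral_expo_mul (hfL.integrable one_le_two) fun j => ?_
      have h := (Submodule.mem_orthogonal _ _).1 hf (v (-j))
        (Submodule.subset_span (mem_range_self _))
      rw [hff, hinner] at h
      simp only [map_mul, conj_expo, neg_neg, mul_assoc] at h
      rw [integral_const_mul] at h
      refine (mul_eq_zero.1 h).resolve_left ?_
      rw [map_inv₀, Complex.conj_ofReal]
      exact inv_ne_zero hsq0
    exact (Lp.eq_zero_iff_ae_eq_zero).2 this
  let b := HilbertBasis.mkOfOrthogonalEqBot hv hbot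
  have hb : ∀ j, b j = v j := fun j => by simp [b]
  have hφ' : MemLp (fun s => conj (φ s)) 2 circ := hφ.star
  have hsum := b.tsum_inner_mul_inner (hφ'.toLp _) (hψ.toLp _)
  rw [hinner] at hsum
  simp only [Complex.conj_conj] at hsum
  rw [← hsum]
  -- In Parseval's sum the term of index `j` vanishes through `φ` when `j ≥ 0` and through `ψ` when
  -- `j < 0`.
  convert tsum_zero with j
  rw [hb]
  by_cases hj : 0 ≤ j
  · have : inner ℂ (hφ'.toLp _) (v j) = 0 := by
      rw [hinner]
      simp only [Complex.conj_conj]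
      have : ∀ s, φ s * (((√(2 * Real.pi))⁻¹ : ℂ) * expo j s)
        = ((√(2 * Real.pi))⁻¹ : ℂ) * (expo j s * φ s) := fun s => by ring
      simp only [this]
      rw [integral_const_mul, h0 j hj, mul_zero]
    rw [this, zero_mul]
  · have : inner ℂ (v j) (hψ.toLp _) = 0 := by
      rw [hinner]
      simp only [map_mul, conj_expo, mul_assoc]
      rw [integral_const_mul, h1 (-j) (by omega), mul_zero]
    rw [this, mul_zero]

/-! ### An extremal problem of Szegő -/

theorem inner_toLp {f g : ℝ → ℂ} (hf : MemLp f 2 circ) (hg : MemLp g 2 circ) :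
    inner ℂ (hf.toLp f) (hg.toLp g) = ∫ s, conj (f s) * g s ∂circ := by
  rw [L2.inner_def]
  refine integral_congr_ae ?_
  filter_upwards [hf.coeFn_toLp, hg.coeFn_toLp] with s h1 h2
  rw [h1, h2, RCLike.inner_apply, mul_comm]

theorem memLp_two_of_integrable_sq_norm {E : Type*} [NormedAddCommGroup E] {f : ℝ → E}
    (hf : AEStronglyMeasurable f circ) (h : Integrable (fun s => ‖f s‖ ^ 2) circ) :
    MemLp f 2 circ :=
  (memLp_two_iff_integrable_sq_norm hf).2 h

theorem norm_sq_eq_integral {E : Type*} [NormedAddCommGroup E] [InnerProductSpace ℂ E]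
    (f : Lp E 2 circ) : ‖f‖ ^ 2 = ∫ s, ‖(f : ℝ → E) s‖ ^ 2 ∂circ := by
  rw [← inner_self_eq_norm_sq (𝕜 := ℂ) f, L2.inner_def, ← integral_re (L2.integrable_inner f f)]
  simp only [inner_self_eq_norm_sq]

theorem norm_toLp_sq {E : Type*} [NormedAddCommGroup E] [InnerProductSpace ℂ E] {f : ℝ → E}
    (hf : MemLp f 2 circ) : ‖hf.toLp f‖ ^ 2 = ∫ s, ‖f s‖ ^ 2 ∂circ := by
  rw [norm_sq_eq_integral]
  refine integral_congr_ae ?_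
  filter_upwards [hf.coeFn_toLp] with s hs
  rw [hs]

theorem inner_eq_zero_of_mem_closure_span {H : Type*} [NormedAddCommGroup H]
    [InnerProductSpace ℂ H] {S : Set H} {x y : H}
    (hx : x ∈ (Submodule.span ℂ S).topologicalClosure) (h : ∀ b ∈ S, inner ℂ b y = 0) :
    inner ℂ x y = 0 := by
  have hy : y ∈ (Submodule.span ℂ S)ᗮ := by
    rw [Submodule.mem_orthogonal]
    intro u hu
    induction hu using Submodule.span_induction with
    | mem b hb => exact h b hb
    | zero => exact inner_zero_left _
    | add a b _ _ ha hb => rw [inner_add_left, ha, hb, add_zero]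
    | smul c a _ ha => rw [inner_smul_left, ha, mul_zero]
  rw [← Submodule.orthogonal_closure] at hy
  exact (Submodule.mem_orthogonal _ _).1 hy x hx

/-- For a weight `1 + δ M` there is an analytic function `p` with `|p|² (1 + δ M)` constant which
is close to `1` in mean square, and multiplication by which preserves analyticity. -/
theorem exists_analytic_sq_norm_mul_weight_eq_const {M : ℝ → ℝ} (hM : Integrable M circ)
    (hM0 : ∀ s, 0 ≤ M s) {δ : ℝ} (hδ : 0 < δ) :
    ∃ (p : ℝ → ℂ) (c : ℝ), AEStronglyMeasurable p circ ∧
      (∀ᵐ s ∂circ, ‖p s‖ ^ 2 * (1 + δ * M s) = c) ∧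
      c ≤ 1 + δ * (2 * Real.pi)⁻¹ * ∫ s, M s ∂circ ∧
      ∫ s, ‖p s - 1‖ ^ 2 ∂circ ≤ δ * ∫ s, M s ∂circ ∧
      ∀ φ : ℝ → ℂ, AEStronglyMeasurable φ circ →
        Integrable (fun s => ‖φ s‖ ^ 2 / (1 + δ * M s)) circ →
        ∀ j₀ : ℤ, (∀ j, j₀ ≤ j → ∫ s, expo j s * φ s ∂circ = 0) →
          ∀ j, j₀ ≤ j → ∫ s, expo j s * (p s * φ s) ∂circ = 0 := by
  set W : ℝ → ℝ := fun s => 1 + δ * M s with hWdef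
  have hW1 : ∀ s, 1 ≤ W s := fun s => by
    have := mul_nonneg hδ.le (hM0 s)
    simp only [hWdef]; linarith
  have hWi : Integrable W circ := (integrable_const _).add (hM.const_mul δ)
  have hWint : ∫ s, W s ∂circ = 2 * Real.pi + δ * ∫ s, M s ∂circ := by
    rw [hWdef, integral_add (integrable_const _) (hM.const_mul δ), integral_const_mul,
      integral_const, measureReal_circ_univ, smul_eq_mul, mul_one]
  set w : ℝ → ℝ := fun s => √(W s) with hwdef
  have hwsq : ∀ s, w s ^ 2 = W s := fun s => Real.sq_sqrt (zero_le_one.trans (hW1 s))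
  have hwpos : ∀ s, 0 < w s := fun s => Real.sqrt_pos.mpr (zero_lt_one.trans_le (hW1 s))
  have hw0 : ∀ s, (w s : ℂ) ≠ 0 := fun s => by exact_mod_cast (hwpos s).ne'
  have hwm : AEStronglyMeasurable (fun s => (w s : ℂ)) circ :=
    Complex.continuous_ofReal.comp_aestronglyMeasurable
      (Real.continuous_sqrt.comp_aestronglyMeasurable hWi.1)
  have hwim : AEStronglyMeasurable (fun s => ((w s)⁻¹ : ℂ)) circ := hwm.inv₀
  have hb : ∀ j : ℤ, MemLp (fun s => (w s : ℂ) * expo j s) 2 circ := fun j => by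
    refine memLp_two_of_integrable_sq_norm (hwm.mul (aestronglyMeasurable_expo j)) ?_
    simpa [norm_expo, hwsq] using hWi
  have hdiv : ∀ φ : ℝ → ℂ, AEStronglyMeasurable φ circ →
      Integrable (fun s => ‖φ s‖ ^ 2 / W s) circ → ∀ j : ℤ,
      MemLp (fun s => conj ((w s : ℂ)⁻¹ * (expo j s * φ s))) 2 circ := fun φ hφ hφi j => by
    refine MemLp.star (f := fun s => (w s : ℂ)⁻¹ * (expo j s * φ s)) ?_
    refine memLp_two_of_integrable_sq_norm (hwim.mul ((aestronglyMeasurable_expo j).mul hφ)) ?_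
    refine hφi.congr (Eventually.of_forall fun s => ?_)
    simp only [norm_mul, norm_inv, norm_expo, mul_pow, inv_pow, one_mul, Complex.norm_real,
      Real.norm_eq_abs, sq_abs, hwsq]
    rw [div_eq_inv_mul]
  -- Szegő's problem in the weighted space: `r` is the part of the constant function orthogonal to
  -- the exponentials of index at least 1, each multiplied by `w = √W`. The required `p` is `r / w`.
  let β : ℤ → Lp ℂ 2 circ := fun j => (hb j).toLp _
  let N : Submodule ℂ (Lp ℂ 2 circ) := (Submodule.span ℂ (β '' {j | 1 ≤ j})).topologicalClosure
  let N₀ : Submodule ℂ (Lp ℂ 2 circ) := (Submodule.span ℂ (β '' {j | 0 ≤ j})).topologicalClosure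
  let r : Lp ℂ 2 circ := β 0 - N.starProjection (β 0)
  have hprojN : N.starProjection (β 0) ∈ N := N.starProjection_apply_mem _
  have hrperp : r ∈ Nᗮ := N.sub_starProjection_mem_orthogonal _
  have hβN : ∀ j, 1 ≤ j → β j ∈ N := fun j hj =>
    Submodule.le_topologicalClosure _ (Submodule.subset_span (mem_image_of_mem _ hj))
  have hNN₀ : N ≤ N₀ := Submodule.topologicalClosure_mono
    (Submodule.span_mono (image_mono fun j (hj : 1 ≤ j) => (zero_le_one.trans hj : (0 : ℤ) ≤ j)))
  have hr₀ : r ∈ N₀ := N₀.sub_mem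
    (Submodule.le_topologicalClosure _ (Submodule.subset_span (mem_image_of_mem _ (le_refl (0 : ℤ)))))
    (hNN₀ hprojN)
  have hrL : MemLp (r : ℝ → ℂ) 2 circ := Lp.memLp r
  have hrr : hrL.toLp (r : ℝ → ℂ) = r := Lp.toLp_coeFn r hrL
  have hrin : ∀ {g : ℝ → ℂ} (hg : MemLp g 2 circ),
      inner ℂ r (hg.toLp g) = ∫ s, conj ((r : ℝ → ℂ) s) * g s ∂circ := fun hg => by
    rw [← inner_toLp hrL hg, hrr]
  have hrβ : ∀ j, 1 ≤ j → ∫ s, conj ((r : ℝ → ℂ) s) * (w s * expo j s) ∂circ = 0 := fun j hj => by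
    have := (Submodule.mem_orthogonal' _ _).1 hrperp _ (hβN j hj)
    rwa [hrin] at this
  have hr2i : Integrable (fun s => ‖(r : ℝ → ℂ) s‖ ^ 2) circ :=
    (memLp_two_iff_integrable_sq_norm hrL.1).1 hrL
  have hr2 : Integrable (fun s => conj ((r : ℝ → ℂ) s) * (r : ℝ → ℂ) s) circ := by
    refine hr2i.ofReal.congr (Eventually.of_forall fun s => ?_)
    simp [Complex.conj_mul']
  -- Multiplication by e^{ijs} with `j ≥ 1` maps `N₀` into `N`. Since `r` lies in `N₀` and is
  -- orthogonal to `N`, the Fourier coefficients of |r|² of nonzero index vanish, and |r|² is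
  -- constant.
  have hpos : ∀ j : ℤ, 1 ≤ j →
      ∫ s, expo j s * (conj ((r : ℝ → ℂ) s) * (r : ℝ → ℂ) s) ∂circ = 0 := fun j hj => by
    have hm : MemLp (fun s => expo (-j) s * (r : ℝ → ℂ) s) 2 circ := by
      refine memLp_two_of_integrable_sq_norm ((aestronglyMeasurable_expo _).mul hrL.1) ?_
      simpa [norm_expo] using hr2i
    have h0 : inner ℂ r (hm.toLp _) = 0 := by
      refine inner_eq_zero_of_mem_closure_span hr₀ ?_
      rintro _ ⟨i, hi, rfl⟩
      rw [inner_toLp, ← RingHom.map_zero (starRingEnd ℂ), ← hrβ (i + j) (by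
        have : (0 : ℤ) ≤ i := hi
        omega), ← integral_conj]
      congr 1
      funext s
      simp only [map_mul, Complex.conj_conj, conj_expo, Complex.conj_ofReal, expo_add]
      ring
    rw [hrin] at h0
    rw [← RingHom.map_zero (starRingEnd ℂ), ← h0, ← integral_conj]
    congr 1
    funext s
    simp only [map_mul, Complex.conj_conj, conj_expo, neg_neg]
    ring
  have hconst := ae_eq_const_of_integral_expo_mul hr2 fun j hj => by
    rcases lt_or_gt_of_ne hj with hj | hj
    · rw [← RingHom.map_zero (starRingEnd ℂ), ← hpos (-j) (by omega), ← integral_conj]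
      congr 1
      funext s
      simp only [map_mul, Complex.conj_conj, conj_expo, neg_neg]
      ring
    · exact hpos j (by omega)
  set c : ℝ := (2 * Real.pi)⁻¹ * ∫ s, ‖(r : ℝ → ℂ) s‖ ^ 2 ∂circ with hc
  have hrc : ∀ᵐ s ∂circ, ‖(r : ℝ → ℂ) s‖ ^ 2 = c := by
    filter_upwards [hconst] with s hs
    have hcc : ((2 * (Real.pi : ℂ))⁻¹ * ∫ t, conj ((r : ℝ → ℂ) t) * (r : ℝ → ℂ) t ∂circ)
        = (c : ℂ) := by
      simp only [Complex.conj_mul']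
      rw [hc]
      push_cast
      rw [← integral_complex_ofReal]
      simp
    rw [hcc, Complex.conj_mul'] at hs
    exact_mod_cast hs
  have hrnorm : ∫ s, ‖(r : ℝ → ℂ) s‖ ^ 2 ∂circ ≤ ∫ s, W s ∂circ := by
    have h1 : ∫ s, ‖(r : ℝ → ℂ) s‖ ^ 2 ∂circ = ‖r‖ ^ 2 := (norm_sq_eq_integral r).symm
    have h2 : ∫ s, W s ∂circ = ‖β 0‖ ^ 2 := by
      rw [norm_toLp_sq]
      simp [norm_expo, hwsq]
    rw [h1, h2]
    have h3 : ‖r‖ ≤ ‖β 0‖ := by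
      have h4 : inner ℂ r r = inner ℂ r (β 0) := by
        have : inner ℂ r (N.starProjection (β 0)) = 0 :=
          (Submodule.mem_orthogonal' _ _).1 hrperp _ hprojN
        change inner ℂ r (β 0 - N.starProjection (β 0)) = _
        rw [inner_sub_right, this, sub_zero]
      have h5 : ‖r‖ * ‖r‖ ≤ ‖r‖ * ‖β 0‖ := by
        rw [← inner_self_eq_norm_mul_norm (𝕜 := ℂ), h4]
        exact re_inner_le_norm _ _
      by_cases h6 : ‖r‖ = 0
      · rw [h6]; exact norm_nonneg _
      · exact le_of_mul_le_mul_left h5 (lt_of_le_of_ne (norm_nonneg _) (Ne.symm h6))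
    gcongr
  have hpm : AEStronglyMeasurable (fun s => (w s : ℂ)⁻¹ * (r : ℝ → ℂ) s) circ := hwim.mul hrL.1
  have hpr : ∀ s, ‖(w s : ℂ)⁻¹ * (r : ℝ → ℂ) s‖ ^ 2 = ‖(r : ℝ → ℂ) s‖ ^ 2 / W s := fun s => by
    rw [norm_mul, mul_pow, norm_inv, inv_pow, Complex.norm_real, Real.norm_eq_abs, sq_abs, hwsq,
      div_eq_inv_mul]
  have hple : ∀ s, ‖(w s : ℂ)⁻¹ * (r : ℝ → ℂ) s‖ ^ 2 ≤ ‖(r : ℝ → ℂ) s‖ ^ 2 := fun s => by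
    rw [hpr]
    exact div_le_self (sq_nonneg _) (hW1 s)
  have hp2 : MemLp (fun s => (w s : ℂ)⁻¹ * (r : ℝ → ℂ) s) 2 circ := by
    refine memLp_two_of_integrable_sq_norm hpm ?_
    exact hr2i.mono' (hpm.norm.pow 2) (Eventually.of_forall fun s => by
      rw [Real.norm_of_nonneg (sq_nonneg _)]; exact hple s)
  have hpi : Integrable (fun s => (w s : ℂ)⁻¹ * (r : ℝ → ℂ) s) circ := hp2.integrable one_le_two
  -- The function `1 / w` is orthogonal to every `β i` with `i ≠ 0`, so its product with `r` is that
  -- with `β 0`, namely 2π.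
  have hmean : ∫ s, (w s : ℂ)⁻¹ * (r : ℝ → ℂ) s ∂circ = 2 * Real.pi := by
    have hone := hdiv (fun _ => 1) aestronglyMeasurable_const
      ((integrable_const (1 : ℝ)).mono' (by
        simp only [norm_one, one_pow, one_div]
        exact (hWi.1.aemeasurable.inv).aestronglyMeasurable) (Eventually.of_forall fun s => by
          rw [norm_one, one_pow, one_div, norm_inv, Real.norm_of_nonneg (zero_le_one.trans (hW1 s))]
          exact inv_le_one_of_one_le₀ (hW1 s))) 0
    have hβi : ∀ i : ℤ, inner ℂ (β i) (hone.toLp _) = if i = 0 then 2 * (Real.pi : ℂ) else 0 := by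
      intro i
      rw [inner_toLp]
      have : ∀ s, conj ((w s : ℂ) * expo i s) * conj ((w s : ℂ)⁻¹ * (expo 0 s * 1))
          = expo (-i) s := fun s => by
        rw [← conj_expo, ← map_mul]
        congr 1
        rw [expo_zero]
        field_simp [hw0 s]
      simp only [this]
      rw [integral_expo]
      simp
    have h1 : inner ℂ r (hone.toLp _) = 2 * (Real.pi : ℂ) := by
      have : inner ℂ (N.starProjection (β 0)) (hone.toLp _) = 0 := by
        refine inner_eq_zero_of_mem_closure_span hprojN ?_
        rintro _ ⟨i, hi, rfl⟩
        have : (1 : ℤ) ≤ i := hi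
        rw [hβi, if_neg (by omega)]
      change inner ℂ (β 0 - N.starProjection (β 0)) _ = _
      rw [inner_sub_left, this, sub_zero, hβi, if_pos rfl]
    rw [hrin] at h1
    have h2 : conj (2 * (Real.pi : ℂ)) = 2 * Real.pi := by
      rw [map_mul, Complex.conj_ofReal, Complex.conj_ofNat]
    rw [← h2, ← h1, ← integral_conj]
    congr 1
    funext s
    simp only [map_mul, Complex.conj_conj, expo_zero, mul_one]
    ring
  refine ⟨fun s => (w s : ℂ)⁻¹ * (r : ℝ → ℂ) s, c, hpm, ?_, ?_, ?_, ?_⟩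
  · filter_upwards [hrc] with s hs
    rw [hpr, hs, div_mul_cancel₀ _ (zero_lt_one.trans_le (hW1 s)).ne']
  · have h2pi : (0 : ℝ) < 2 * Real.pi := Real.two_pi_pos
    calc c ≤ (2 * Real.pi)⁻¹ * (2 * Real.pi + δ * ∫ s, M s ∂circ) := by
          rw [hc, ← hWint]
          gcongr
      _ = _ := by field_simp
  -- Expanding the square: ∫|p|² ≤ ∫|r|² ≤ 2π + δ ∫M, and the mean value of `p` contributes -4π +
  -- 2π.
  · have hexp : ∀ s, ‖(w s : ℂ)⁻¹ * (r : ℝ → ℂ) s - 1‖ ^ 2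
        = ‖(w s : ℂ)⁻¹ * (r : ℝ → ℂ) s‖ ^ 2 - 2 * ((w s : ℂ)⁻¹ * (r : ℝ → ℂ) s).re + 1 := fun s => by
      rw [← Complex.normSq_eq_norm_sq, ← Complex.normSq_eq_norm_sq, Complex.normSq_sub]
      simp
      ring
    simp only [hexp]
    have hp2i := (memLp_two_iff_integrable_sq_norm hpm).1 hp2
    have hre : ∫ s, ((w s : ℂ)⁻¹ * (r : ℝ → ℂ) s).re ∂circ = 2 * Real.pi := by
      have := integral_re hpi
      simp only [RCLike.re_to_complex] at this
      rw [this, hmean]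
      simp
    have hpre : Integrable (fun s => 2 * ((w s : ℂ)⁻¹ * (r : ℝ → ℂ) s).re) circ :=
      hpi.re.const_mul 2
    rw [integral_add (f := fun s => ‖(w s : ℂ)⁻¹ * (r : ℝ → ℂ) s‖ ^ 2
        - 2 * ((w s : ℂ)⁻¹ * (r : ℝ → ℂ) s).re) (hp2i.sub hpre) (integrable_const _),
      integral_sub hp2i hpre, integral_const_mul, integral_const,
      measureReal_circ_univ]
    rw [hre]
    have : ∫ s, ‖(w s : ℂ)⁻¹ * (r : ℝ → ℂ) s‖ ^ 2 ∂circ ≤ ∫ s, ‖(r : ℝ → ℂ) s‖ ^ 2 ∂circ :=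
      integral_mono hp2i hr2i hple
    simp only [smul_eq_mul, mul_one]
    linarith
  · intro φ hφ hφi j₀ h0 j hj
    -- Pairing `β i` with the conjugate of e^{ijs} φ / w cancels the weight and leaves a coefficient
    -- of `φ` of index `i + j ≥ j₀`. As `r` lies in `N₀`, the pairing with `r` vanishes too.
    have hm := hdiv φ hφ hφi j
    have h1 : inner ℂ r (hm.toLp _) = 0 := by
      refine inner_eq_zero_of_mem_closure_span hr₀ ?_
      rintro _ ⟨i, hi, rfl⟩
      have : (0 : ℤ) ≤ i := hi
      rw [inner_toLp, ← RingHom.map_zero (starRingEnd ℂ), ← h0 (i + j) (by omega), ← integral_conj]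
      congr 1
      funext s
      rw [← map_mul]
      congr 1
      rw [expo_add]
      field_simp [hw0 s]
    rw [hrin] at h1
    rw [← RingHom.map_zero (starRingEnd ℂ), ← h1, ← integral_conj]
    congr 1
    funext s
    simp only [map_mul, Complex.conj_conj]
    ring

/-- If `φ_k`, `ψ_k` are analytic, with `φ_k` of zero mean, and dominated by integrable weights, and
if `∑ φ_k ψ_k` is integrable, then its integral is zero. -/
theorem integral_sum_mul_eq_zero_of_analytic {ι : Type*} [Fintype ι] {M V : ℝ → ℝ}
    (hM : Integrable M circ) (hM0 : ∀ s, 0 ≤ M s) (hV : Integrable V circ)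
    {φ ψ : ι → ℝ → ℂ}
    (hφm : ∀ k, AEStronglyMeasurable (φ k) circ) (hψm : ∀ k, AEStronglyMeasurable (ψ k) circ)
    (hφM : ∀ k, ∀ᵐ s ∂circ, ‖φ k s‖ ^ 2 ≤ M s * V s)
    (hψM : ∀ k, ∀ᵐ s ∂circ, ‖ψ k s‖ ^ 2 ≤ M s * V s) (hV0 : ∀ s, 0 ≤ V s)
    (hφ : ∀ k, ∀ j : ℤ, 0 ≤ j → ∫ s, expo j s * φ k s ∂circ = 0)
    (hψ : ∀ k, ∀ j : ℤ, 1 ≤ j → ∫ s, expo j s * ψ k s ∂circ = 0)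
    (hsum : Integrable (fun s => ∑ k, φ k s * ψ k s) circ) :
    ∫ s, ∑ k, φ k s * ψ k s ∂circ = 0 := by
  have hδ : ∀ n : ℕ, (0 : ℝ) < 1 / ((n : ℝ) + 1) := fun n => by positivity
  choose p c hpm hpc hcle hp1 hpan using fun n : ℕ =>
    exists_analytic_sq_norm_mul_weight_eq_const hM hM0 (hδ n)
  have hMint : 0 ≤ ∫ s, M s ∂circ := integral_nonneg hM0
  set C : ℝ := 1 + (2 * Real.pi)⁻¹ * ∫ s, M s ∂circ with hC
  have hcC : ∀ n, c n ≤ C := fun n => by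
    refine (hcle n).trans ?_
    have : (1 : ℝ) / ((n : ℝ) + 1) ≤ 1 := by
      rw [div_le_one (by positivity)]
      linarith [(Nat.cast_nonneg n : (0 : ℝ) ≤ n)]
    rw [hC, mul_assoc]
    have h2 : 0 ≤ (2 * Real.pi)⁻¹ * ∫ s, M s ∂circ := by positivity
    nlinarith
  have hweight : ∀ (n : ℕ) (s : ℝ), 0 < 1 + 1 / ((n : ℝ) + 1) * M s := fun n s => by
    have := mul_nonneg (hδ n).le (hM0 s)
    linarith
  have hpC : ∀ n, ∀ᵐ s ∂circ, ‖p n s‖ ^ 2 ≤ C := fun n => by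
    filter_upwards [hpc n] with s hs
    refine le_trans ?_ (hcC n)
    rw [← hs]
    have := mul_nonneg (hδ n).le (hM0 s)
    nlinarith [sq_nonneg ‖p n s‖]
  -- With δ = 1/(n+1), M V / (1 + δ M) ≤ V / δ. Hence |p f|² = c |f|² / (1 + δ M) is integrable.
  have hdom : ∀ (n : ℕ) (f : ℝ → ℂ), AEStronglyMeasurable f circ →
      (∀ᵐ s ∂circ, ‖f s‖ ^ 2 ≤ M s * V s) →
      Integrable (fun s => ‖f s‖ ^ 2 / (1 + 1 / ((n : ℝ) + 1) * M s)) circ := fun n f hf hfM => by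
    refine (hV.const_mul ((n : ℝ) + 1)).mono' ?_ ?_
    · exact ((hf.norm.aemeasurable.pow_const 2).div
        ((hM.1.aemeasurable.const_mul _).const_add _)).aestronglyMeasurable
    · filter_upwards [hfM] with s hs
      rw [Real.norm_of_nonneg (div_nonneg (sq_nonneg _) (hweight n s).le), div_le_iff₀ (hweight n s)]
      refine hs.trans ?_
      have hn : (0 : ℝ) < (n : ℝ) + 1 := by positivity
      have : ((n : ℝ) + 1) * V s * (1 + 1 / ((n : ℝ) + 1) * M s)
          = ((n : ℝ) + 1) * V s + M s * V s := by field_simp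
      rw [this]
      have := mul_nonneg hn.le (hV0 s)
      linarith
  have hL2 : ∀ (n : ℕ) (f : ℝ → ℂ), AEStronglyMeasurable f circ →
      (∀ᵐ s ∂circ, ‖f s‖ ^ 2 ≤ M s * V s) → MemLp (fun s => p n s * f s) 2 circ :=
    fun n f hf hfM => by
    refine memLp_two_of_integrable_sq_norm ((hpm n).mul hf) ?_
    refine ((hdom n f hf hfM).const_mul (c n)).congr ?_
    filter_upwards [hpc n] with s hs
    have h0 := (hweight n s).ne'
    rw [norm_mul, mul_pow, ← hs]
    generalize 1 + 1 / ((n : ℝ) + 1) * M s = x at h0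
    field_simp
  -- One factor `p n` goes to `φ k` and one to `ψ k`, so the square integrable case applies to each
  -- term.
  have hzero : ∀ n, ∫ s, p n s ^ 2 * ∑ k, φ k s * ψ k s ∂circ = 0 := fun n => by
    have : ∀ s, p n s ^ 2 * ∑ k, φ k s * ψ k s = ∑ k, (p n s * φ k s) * (p n s * ψ k s) := fun s => by
      rw [Finset.mul_sum]
      exact Finset.sum_congr rfl fun k _ => by ring
    simp only [this]
    rw [integral_finsetSum (f := fun k s => (p n s * φ k s) * (p n s * ψ k s)) _ fun k _ =>
      (hL2 n _ (hφm k) (hφM k)).integrable_mul (hL2 n _ (hψm k) (hψM k))]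
    refine Finset.sum_eq_zero fun k _ => ?_
    exact integral_mul_eq_zero_of_analytic (hL2 n _ (hφm k) (hφM k)) (hL2 n _ (hψm k) (hψM k))
      (hpan n _ (hφm k) (hdom n _ (hφm k) (hφM k)) 0 (hφ k))
      (hpan n _ (hψm k) (hdom n _ (hψm k) (hψM k)) 1 (hψ k))
  have hpL2 : ∀ n, MemLp (fun s => p n s - 1) 2 circ := fun n => by
    refine MemLp.sub ?_ (memLp_const 1)
    refine MemLp.of_bound (hpm n) (√C) ?_
    filter_upwards [hpC n] with s hs
    exact Real.le_sqrt_of_sq_le hs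
  have htend : Tendsto (fun n => eLpNorm (p n - fun _ => 1) 2 circ) atTop (𝓝 0) := by
    have hle : ∀ n, eLpNorm (p n - fun _ => 1) 2 circ
        ≤ ENNReal.ofReal (√(1 / ((n : ℝ) + 1) * ∫ s, M s ∂circ)) := fun n => by
      have h := (hpL2 n).eLpNorm_eq_integral_rpow_norm (by simp) (by simp)
      have h' : eLpNorm (p n - fun _ => 1) 2 circ
          = ENNReal.ofReal (√(∫ s, ‖p n s - 1‖ ^ 2 ∂circ)) := by
        refine h.trans ?_
        rw [Real.sqrt_eq_rpow]
        simp
      rw [h']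
      exact ENNReal.ofReal_le_ofReal (Real.sqrt_le_sqrt (hp1 n))
    refine tendsto_of_tendsto_of_tendsto_of_le_of_le tendsto_const_nhds ?_
      (fun _ => zero_le) hle
    have h1 : Tendsto (fun n : ℕ => √(1 / ((n : ℝ) + 1) * ∫ s, M s ∂circ)) atTop (𝓝 0) := by
      have := (tendsto_one_div_add_atTop_nhds_zero_nat (𝕜 := ℝ)).mul_const (∫ s, M s ∂circ)
      rw [zero_mul] at this
      simpa using this.sqrt
    simpa using ENNReal.tendsto_ofReal h1
  -- Mean square convergence of `p n` to 1 gives almost everywhere convergence along a subsequence;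
  -- the uniform bound |p|² ≤ C then allows dominated convergence.
  obtain ⟨ns, hns, hae⟩ := (tendstoInMeasure_of_tendsto_eLpNorm two_ne_zero (fun n => hpm n)
    aestronglyMeasurable_const htend).exists_seq_tendsto_ae
  have hlim : Tendsto (fun i => ∫ s, p (ns i) s ^ 2 * ∑ k, φ k s * ψ k s ∂circ) atTop
      (𝓝 (∫ s, ∑ k, φ k s * ψ k s ∂circ)) := by
    refine tendsto_integral_of_dominated_convergence (fun s => C * ‖∑ k, φ k s * ψ k s‖)
      (fun i => ((hpm _).pow 2).mul hsum.1) (hsum.norm.const_mul C) (fun i => ?_) ?_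
    · filter_upwards [hpC (ns i)] with s hs
      rw [norm_mul, norm_pow]
      gcongr
    · filter_upwards [hae] with s hs
      simpa using (hs.pow 2).mul_const (∑ k, φ k s * ψ k s)
  simp only [hzero] at hlim
  exact tendsto_nhds_unique hlim tendsto_const_nhds

/-! ### Vector-valued trigonometric polynomials in a weighted space -/

theorem aestronglyMeasurable_apply {E F : Type*} [NormedAddCommGroup E] [NormedSpace ℂ E]
    [NormedAddCommGroup F] [NormedSpace ℂ F] {T : ℝ → E →L[ℂ] F} {y : ℝ → E}
    (hT : AEStronglyMeasurable T circ) (hy : AEStronglyMeasurable y circ) :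
    AEStronglyMeasurable (fun s => T s (y s)) circ :=
  (isBoundedBilinearMap_apply (𝕜 := ℂ)).continuous.comp_aestronglyMeasurable (hT.prodMk hy)

theorem memLp_apply_of_bound {E F : Type*} [NormedAddCommGroup E] [NormedSpace ℂ E]
    [NormedAddCommGroup F] [NormedSpace ℂ F] {T : ℝ → E →L[ℂ] F} (hT : MemLp T 2 circ)
    {y : ℝ → E} (hy : AEStronglyMeasurable y circ) {C : ℝ} (hC : ∀ s, ‖y s‖ ≤ C) :
    MemLp (fun s => T s (y s)) 2 circ := by
  refine hT.of_le_mul (c := C) (aestronglyMeasurable_apply hT.1 hy) (Eventually.of_forall fun s => ?_)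
  rw [mul_comm]
  exact (T s).le_opNorm_of_le (hC s)

section

variable {E : Type*} [NormedAddCommGroup E] [InnerProductSpace ℂ E]

/-- The vector-valued exponential `s ↦ e^{ijs} x`. -/
noncomputable def trig (j : ℤ) (x : E) (s : ℝ) : E := expo j s • x

theorem norm_trig (j : ℤ) (x : E) (s : ℝ) : ‖trig j x s‖ = ‖x‖ := by
  rw [trig, norm_smul, norm_expo, one_mul]

theorem continuous_trig (j : ℤ) (x : E) : Continuous (trig j x) :=
  (continuous_expo j).smul continuous_const

theorem memLp_apply_trig {T : ℝ → E →L[ℂ] E} (hT : MemLp T 2 circ) (j : ℤ) (x : E) :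
    MemLp (fun s => T s (trig j x s)) 2 circ :=
  memLp_apply_of_bound hT (continuous_trig j x).aestronglyMeasurable fun s => (norm_trig j x s).le

theorem inner_trig_left (j : ℤ) (x y : E) (s : ℝ) :
    inner ℂ (trig j x s) y = expo (-j) s * inner ℂ x y := by
  rw [trig, inner_smul_left, conj_expo]

/-- A measurable self-adjoint square integrable operator function `T` together with its square
integrable inverse `S`. -/
structure IsFactorPair (T S : ℝ → E →L[ℂ] E) : Prop where
  memLp : MemLp T 2 circ
  memLp_inv : MemLp S 2 circ
  symm : ∀ᵐ s ∂circ, ∀ x y, inner ℂ (T s x) y = inner ℂ x (T s y)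
  symm_inv : ∀ᵐ s ∂circ, ∀ x y, inner ℂ (S s x) y = inner ℂ x (S s y)
  apply_inv : ∀ᵐ s ∂circ, ∀ x, T s (S s x) = x
  inv_apply : ∀ᵐ s ∂circ, ∀ x, S s (T s x) = x

/-- A function `v` such that `T v` has no Fourier coefficients of negative index and `T⁻¹ v` has no
Fourier coefficients of nonnegative index is zero. -/
theorem IsFactorPair.ae_eq_zero [FiniteDimensional ℂ E] {T S : ℝ → E →L[ℂ] E}
    (h : IsFactorPair T S) {ι : Type*} [Fintype ι] (b : OrthonormalBasis ι ℂ E)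
    {v : ℝ → E} (hv : MemLp v 2 circ)
    (hneg : ∀ (j : ℤ) (k : ι), j < 0 → ∫ s, inner ℂ (trig j (b k) s) (T s (v s)) ∂circ = 0)
    (hpos : ∀ (j : ℤ) (k : ι), 0 ≤ j → ∫ s, inner ℂ (trig j (b k) s) (S s (v s)) ∂circ = 0) :
    v =ᵐ[circ] 0 := by
  have hT2 := (memLp_two_iff_integrable_sq_norm h.memLp.1).1 h.memLp
  have hS2 := (memLp_two_iff_integrable_sq_norm h.memLp_inv.1).1 h.memLp_inv
  have hv2 := (memLp_two_iff_integrable_sq_norm hv.1).1 hv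
  have hTv : AEStronglyMeasurable (fun s => T s (v s)) circ :=
    aestronglyMeasurable_apply h.memLp.1 hv.1
  have hSv : AEStronglyMeasurable (fun s => S s (v s)) circ :=
    aestronglyMeasurable_apply h.memLp_inv.1 hv.1
  have hbd : ∀ (k : ι) (R : E →L[ℂ] E) (x : E), ‖inner ℂ (b k) (R x)‖ ^ 2 ≤ ‖R‖ ^ 2 * ‖x‖ ^ 2 := by
    intro k R x
    rw [← mul_pow]
    gcongr
    refine (norm_inner_le_norm _ _).trans ?_
    rw [b.norm_eq_one, one_mul]
    exact R.le_opNorm x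
  -- The sum is ⟨S v, T v⟩ = ⟨T S v, v⟩ = ‖v‖², which makes it integrable although its separate
  -- terms need not be.
  have hsq : ∀ᵐ s ∂circ, ∑ k, conj (inner ℂ (b k) (S s (v s))) * inner ℂ (b k) (T s (v s))
      = ((‖v s‖ ^ 2 : ℝ) : ℂ) := by
    filter_upwards [h.symm, h.apply_inv] with s h1 h2
    simp only [inner_conj_symm]
    rw [b.sum_inner_mul_inner, ← h1, h2, inner_self_eq_norm_sq_to_K]
    simp
  have hzero := integral_sum_mul_eq_zero_of_analytic (M := fun s => ‖T s‖ ^ 2 + ‖S s‖ ^ 2)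
    (V := fun s => ‖v s‖ ^ 2) (φ := fun k s => conj (inner ℂ (b k) (S s (v s))))
    (ψ := fun k s => inner ℂ (b k) (T s (v s))) (hT2.add hS2) (fun s => by positivity) hv2
    (fun k => Complex.continuous_conj.comp_aestronglyMeasurable
      (aestronglyMeasurable_const.inner hSv))
    (fun k => aestronglyMeasurable_const.inner hTv)
    (fun k => Eventually.of_forall fun s => by
      rw [RCLike.norm_conj]
      refine (hbd k (S s) (v s)).trans ?_
      gcongr
      exact le_add_of_nonneg_left (sq_nonneg _))
    (fun k => Eventually.of_forall fun s => by
      refine (hbd k (T s) (v s)).trans ?_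
      gcongr
      exact le_add_of_nonneg_right (sq_nonneg _))
    (fun s => sq_nonneg _)
    (fun k j hj => by
      have := hpos j k hj
      simp only [inner_trig_left] at this
      rw [← RingHom.map_zero (starRingEnd ℂ), ← this, ← integral_conj]
      simp [conj_expo])
    (fun k j hj => by
      have := hneg (-j) k (by omega)
      simpa only [inner_trig_left, neg_neg] using this)
    (hv2.ofReal.congr (by filter_upwards [hsq] with s hs using hs.symm))
  rw [integral_congr_ae hsq, integral_complex_ofReal] at hzero
  have hz : ∫ s, ‖v s‖ ^ 2 ∂circ = 0 := by exact_mod_cast hzero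
  rw [integral_eq_zero_iff_of_nonneg (fun s => sq_nonneg _) hv2] at hz
  filter_upwards [hz] with s hs
  simpa using hs

/-- The closed span of the functions `T e^{ijs} b_k`, `j < 0`. -/
noncomputable def pastSpace {ι : Type*} {T : ℝ → E →L[ℂ] E} (hT : MemLp T 2 circ) (b : ι → E) :
    Submodule ℂ (Lp E 2 circ) :=
  (Submodule.span ℂ {f | ∃ (j : ℤ) (k : ι), j < 0 ∧
    f = (memLp_apply_trig hT j (b k)).toLp _}).topologicalClosure

theorem inner_toLp_left {f : ℝ → E} (hf : MemLp f 2 circ) (g : Lp E 2 circ) :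
    inner ℂ (hf.toLp f) g = ∫ s, inner ℂ (f s) ((g : ℝ → E) s) ∂circ := by
  rw [L2.inner_def]
  refine integral_congr_ae ?_
  filter_upwards [hf.coeFn_toLp] with s h1
  rw [h1]

/-- The functions `T⁻¹ e^{ijs} b_k`, `j ≥ 0`, span a dense subspace of the orthogonal complement of
the past. -/
theorem IsFactorPair.orthogonal_pastSpace [FiniteDimensional ℂ E] {T S : ℝ → E →L[ℂ] E}
    (h : IsFactorPair T S) {ι : Type*} [Fintype ι] (b : OrthonormalBasis ι ℂ E) :
    (pastSpace h.memLp b)ᗮ = (Submodule.span ℂ (Set.range fun q : ℕ × ι =>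
      (memLp_apply_trig h.memLp_inv (q.1 : ℤ) (b q.2)).toLp _)).topologicalClosure := by
  have : CompleteSpace E := FiniteDimensional.complete ℂ E
  set A := (Submodule.span ℂ (Set.range fun q : ℕ × ι =>
    (memLp_apply_trig h.memLp_inv (q.1 : ℤ) (b q.2)).toLp _)).topologicalClosure with hA
  have hAN : A ≤ (pastSpace h.memLp b)ᗮ := by
    refine Submodule.topologicalClosure_minimal _ ?_ (Submodule.isClosed_orthogonal _)
    rw [Submodule.span_le]
    rintro _ ⟨q, rfl⟩
    rw [SetLike.mem_coe, Submodule.mem_orthogonal]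
    intro u hu
    refine inner_eq_zero_of_mem_closure_span hu ?_
    rintro _ ⟨j, k, hj, rfl⟩
    rw [inner_toLp_left]
    -- Symmetry and `T S = 1` cancel the factors and leave an exponential of index `q.1 - j > 0`,
    -- whose integral is zero.
    have h1 : (fun s => inner ℂ (T s (trig j (b k) s))
        (((memLp_apply_trig h.memLp_inv (q.1 : ℤ) (b q.2)).toLp _ : Lp E 2 circ) s))
        =ᵐ[circ] fun s => expo (-j + q.1) s * inner ℂ (b k) (b q.2) := by
      filter_upwards [(memLp_apply_trig h.memLp_inv (q.1 : ℤ) (b q.2)).coeFn_toLp, h.symm,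
        h.apply_inv] with s h1 h2 h3
      rw [h1, h2, h3, inner_trig_left, trig, inner_smul_right, expo_add]
      ring
    rw [integral_congr_ae h1, integral_mul_const, integral_expo, if_neg (by omega), zero_mul]
  refine le_antisymm (fun z hz => ?_) hAN
  -- This difference is orthogonal both to the past and to `A`, which are the two conditions of
  -- `IsFactorPair.ae_eq_zero`.
  have hsub : z - A.starProjection z = 0 := by
    have hperpA : z - A.starProjection z ∈ Aᗮ := A.sub_starProjection_mem_orthogonal _
    have hperpN : z - A.starProjection z ∈ (pastSpace h.memLp b)ᗮ :=
      Submodule.sub_mem _ hz (hAN (A.starProjection_apply_mem _))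
    set v := z - A.starProjection z
    have hv : MemLp (v : ℝ → E) 2 circ := Lp.memLp v
    rw [Lp.eq_zero_iff_ae_eq_zero]
    refine h.ae_eq_zero b hv (fun j k hj => ?_) fun j k hj => ?_
    · have := (Submodule.mem_orthogonal _ _).1 hperpN _ (Submodule.le_topologicalClosure _
        (Submodule.subset_span ⟨j, k, hj, rfl⟩))
      rw [inner_toLp_left] at this
      rw [← this]
      refine integral_congr_ae ?_
      filter_upwards [h.symm] with s hs
      rw [hs]
    · obtain ⟨i, rfl⟩ := Int.eq_ofNat_of_zero_le hj
      have := (Submodule.mem_orthogonal _ _).1 hperpA _ (Submodule.le_topologicalClosure _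
        (Submodule.subset_span ⟨(i, k), rfl⟩))
      rw [inner_toLp_left] at this
      rw [← this]
      refine integral_congr_ae ?_
      filter_upwards [h.symm_inv] with s hs
      rw [hs]
  rw [sub_eq_zero.1 hsub]
  exact A.starProjection_apply_mem _

end

/-- The squared distance to a closed subspace as a supremum over a dense subset of its orthogonal
complement. -/
theorem iSup_two_mul_re_inner_sub_norm_sq {H : Type*} [NormedAddCommGroup H]
    [InnerProductSpace ℂ H] {N : Submodule ℂ H} [N.HasOrthogonalProjection]
    {κ : Type*} {f : κ → H} (hf : Nᗮ = (Submodule.span ℂ (Set.range f)).topologicalClosure)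
    (U : H) :
    ⨆ x : κ →₀ ℂ, ENNReal.ofReal (2 * (inner ℂ (Finsupp.linearCombination ℂ f x) U).re
        - ‖Finsupp.linearCombination ℂ f x‖ ^ 2)
      = ENNReal.ofReal (‖U - N.starProjection U‖ ^ 2) := by
  set y := U - N.starProjection U with hy
  have hyN : y ∈ Nᗮ := N.sub_starProjection_mem_orthogonal _
  have hinner : ∀ z ∈ Nᗮ, inner ℂ z U = inner ℂ z y := fun z hz => by
    rw [hy, inner_sub_right, (Submodule.mem_orthogonal' _ _).1 hz _ (N.starProjection_apply_mem U),
      sub_zero]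
  have hmem : ∀ x : κ →₀ ℂ, Finsupp.linearCombination ℂ f x ∈ Nᗮ := fun x => by
    rw [hf]
    exact Submodule.le_topologicalClosure _
      (Finsupp.mem_span_range_iff_exists_finsupp.2 ⟨x, rfl⟩)
  -- Completing the square shows that the supremum is approached as `z` tends to `y`.
  have hkey : ∀ z : H, 2 * (inner ℂ z y).re - ‖z‖ ^ 2 = ‖y‖ ^ 2 - ‖z - y‖ ^ 2 := fun z => by
    have := norm_sub_sq (𝕜 := ℂ) z y
    rw [this]
    simp only [RCLike.re_to_complex]
    ring
  apply le_antisymm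
  · refine iSup_le fun x => ENNReal.ofReal_le_ofReal ?_
    rw [hinner _ (hmem x), hkey]
    linarith [sq_nonneg ‖Finsupp.linearCombination ℂ f x - y‖]
  · have hcl : y ∈ closure ((Submodule.span ℂ (Set.range f) : Submodule ℂ H) : Set H) := by
      rw [hf] at hyN
      exact hyN
    obtain ⟨u, hu, hlim⟩ := mem_closure_iff_seq_limit.1 hcl
    have hcont : Continuous fun z : H => ENNReal.ofReal (‖y‖ ^ 2 - ‖z - y‖ ^ 2) :=
      ENNReal.continuous_ofReal.comp (by fun_prop)
    have ht := (hcont.tendsto y).comp hlim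
    simp only [sub_self, norm_zero, ne_eq, OfNat.ofNat_ne_zero, not_false_eq_true, zero_pow,
      sub_zero] at ht
    refine le_of_tendsto' ht fun n => ?_
    obtain ⟨x, hx⟩ := Finsupp.mem_span_range_iff_exists_finsupp.1 (hu n)
    have hx' : Finsupp.linearCombination ℂ f x = u n := hx
    refine le_trans (le_of_eq ?_) (le_iSup _ x)
    rw [hinner _ (hmem x), hkey, hx']
    rfl

/-! ### Measurable square roots of operator functions -/

/-- Both kinds of domain are needed: the square root is continuous on the closed cone of nonnegative
operators, inversion on the open set of units. -/
theorem aestronglyMeasurable_comp_of_continuousOn {A B : Type*} [NormedAddCommGroup A]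
    [NormedAddCommGroup B] [SecondCountableTopology B] {f : A → B} {t : Set A}
    (hf : ContinuousOn f t) (ht : IsOpen t ∨ IsClosed t) {g : ℝ → A}
    (hg : AEStronglyMeasurable g circ) (hgt : ∀ᵐ s ∂circ, g s ∈ t) :
    AEStronglyMeasurable (fun s => f (g s)) circ := by
  classical
  borelize A
  borelize B
  have htm : MeasurableSet t := ht.elim IsOpen.measurableSet IsClosed.measurableSet
  have hm : Measurable (t.piecewise f fun _ => 0) :=
    hf.measurable_piecewise continuousOn_const htm
  have : AEMeasurable (fun s => t.piecewise f (fun _ => 0) (g s)) circ :=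
    hm.comp_aemeasurable hg.aemeasurable
  refine this.aestronglyMeasurable.congr ?_
  filter_upwards [hgt] with s hs
  exact Set.piecewise_eq_of_mem _ _ _ hs

section

variable {E : Type*} [NormedAddCommGroup E] [InnerProductSpace ℂ E]

/-- The operator norm is at most the Hilbert–Schmidt norm, by Cauchy–Schwarz on coordinates. -/
theorem norm_sq_le_sum_norm_sq {ι : Type*} [Fintype ι] (b : OrthonormalBasis ι ℂ E)
    (R : E →L[ℂ] E) : ‖R‖ ^ 2 ≤ ∑ k, ‖R (b k)‖ ^ 2 := by
  have hs : 0 ≤ ∑ k, ‖R (b k)‖ ^ 2 := Finset.sum_nonneg fun k _ => sq_nonneg _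
  have h : ‖R‖ ≤ √(∑ k, ‖R (b k)‖ ^ 2) := by
    refine R.opNorm_le_bound (Real.sqrt_nonneg _) fun x => ?_
    have hx : R x = ∑ k, inner ℂ (b k) x • R (b k) := by
      conv_lhs => rw [← b.sum_repr' x]
      simp [map_sum]
    rw [hx]
    calc ‖∑ k, inner ℂ (b k) x • R (b k)‖ ≤ ∑ k, ‖R (b k)‖ * ‖inner ℂ (b k) x‖ := by
          refine (norm_sum_le _ _).trans (le_of_eq ?_)
          exact Finset.sum_congr rfl fun k _ => by rw [norm_smul, mul_comm]
      _ ≤ √(∑ k, ‖R (b k)‖ ^ 2) * √(∑ k, ‖inner ℂ (b k) x‖ ^ 2) :=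
          Real.sum_mul_le_sqrt_mul_sqrt _ _ _
      _ = _ := by rw [b.sum_sq_norm_inner_right, Real.sqrt_sq (norm_nonneg _)]
  calc ‖R‖ ^ 2 ≤ √(∑ k, ‖R (b k)‖ ^ 2) ^ 2 := by gcongr
    _ = _ := Real.sq_sqrt hs

end

section

variable {E : Type*} [NormedAddCommGroup E] [InnerProductSpace ℂ E] [FiniteDimensional ℂ E]

theorem secondCountable_clm : SecondCountableTopology (E →L[ℂ] E) :=
  have : ProperSpace (E →L[ℂ] E) := FiniteDimensional.proper ℂ _
  inferInstance

variable [CompleteSpace E]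

theorem aestronglyMeasurable_sqrt {P : ℝ → E →L[ℂ] E} (hP : AEStronglyMeasurable P circ)
    (hpos : ∀ᵐ s ∂circ, (P s).IsPositive) :
    AEStronglyMeasurable (fun s => CFC.sqrt (P s)) circ := by
  have := secondCountable_clm (E := E)
  refine aestronglyMeasurable_comp_of_continuousOn (f := fun X : E →L[ℂ] E => CFC.sqrt X)
    CFC.continuousOn_sqrt (Or.inr ?_) hP ?_
  · exact isClosed_le continuous_const continuous_id
  · filter_upwards [hpos] with s hs
    exact (ContinuousLinearMap.nonneg_iff_isPositive _).2 hs

theorem aestronglyMeasurable_inverse {P : ℝ → E →L[ℂ] E} (hP : AEStronglyMeasurable P circ)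
    (hu : ∀ᵐ s ∂circ, IsUnit (P s)) :
    AEStronglyMeasurable (fun s => Ring.inverse (P s)) circ := by
  have := secondCountable_clm (E := E)
  refine aestronglyMeasurable_comp_of_continuousOn (f := fun X : E →L[ℂ] E => Ring.inverse X)
    (t := {X | IsUnit X}) ?_ (Or.inl Units.isOpen) hP hu
  rintro _ ⟨u, rfl⟩
  exact (NormedRing.inverse_continuousAt u).continuousWithinAt

/-- The data of a pair of densities `F`, `G`: a self-adjoint factor `T` of `F + G` and its
inverse `S`. -/
structure IsDensityPair (F G T S : ℝ → E →L[ℂ] E) : Prop extends IsFactorPair T S where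
  meas_left : AEStronglyMeasurable F circ
  meas_right : AEStronglyMeasurable G circ
  pos_left : ∀ᵐ s ∂circ, (F s).IsPositive
  pos_right : ∀ᵐ s ∂circ, (G s).IsPositive
  mul_self : ∀ᵐ s ∂circ, T s * T s = F s + G s
  inverse_eq : ∀ᵐ s ∂circ, Ring.inverse (F s + G s) = S s * S s

theorem re_inner_eq_sq_norm_sqrt {E : Type*} [NormedAddCommGroup E] [InnerProductSpace ℂ E]
    [CompleteSpace E] {P : E →L[ℂ] E} (hP : P.IsPositive) (x : E) :
    (inner ℂ x (P x)).re = ‖CFC.sqrt P x‖ ^ 2 := by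
  have hT : (CFC.sqrt P).IsPositive :=
    (ContinuousLinearMap.nonneg_iff_isPositive _).1 (CFC.sqrt_nonneg _)
  conv_lhs =>
    rw [← CFC.sqrt_mul_sqrt_self P ((ContinuousLinearMap.nonneg_iff_isPositive _).2 hP)]
  rw [← inner_self_eq_norm_sq (𝕜 := ℂ)]
  exact (congrArg Complex.re (hT.isSymmetric _ _)).symm

/-- The trace of `P` is the squared Hilbert–Schmidt norm of its square root. Integrable trace
therefore places the square root in L². -/
theorem sq_norm_sqrt_le_trace {E : Type*} [NormedAddCommGroup E] [InnerProductSpace ℂ E]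
    [CompleteSpace E] {ι : Type*} [Fintype ι] (b : OrthonormalBasis ι ℂ E)
    {P : E →L[ℂ] E} (hP : P.IsPositive) :
    ‖CFC.sqrt P‖ ^ 2 ≤ ∑ k, (inner ℂ (b k) (P (b k))).re := by
  simp only [re_inner_eq_sq_norm_sqrt hP]
  exact norm_sq_le_sum_norm_sq b _

theorem re_inner_le_trace {E : Type*} [NormedAddCommGroup E] [InnerProductSpace ℂ E]
    [CompleteSpace E] {ι : Type*} [Fintype ι] (b : OrthonormalBasis ι ℂ E)
    {P : E →L[ℂ] E} (hP : P.IsPositive) {x : E} {C : ℝ} (hx : ‖x‖ ≤ C) :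
    (inner ℂ x (P x)).re ≤ C ^ 2 * ∑ k, (inner ℂ (b k) (P (b k))).re := by
  rw [re_inner_eq_sq_norm_sqrt hP]
  calc ‖CFC.sqrt P x‖ ^ 2 ≤ (‖CFC.sqrt P‖ * C) ^ 2 := by
        gcongr
        exact (CFC.sqrt P).le_opNorm_of_le hx
    _ = C ^ 2 * ‖CFC.sqrt P‖ ^ 2 := by ring
    _ ≤ _ := by
        gcongr
        exact sq_norm_sqrt_le_trace b hP

theorem memLp_sqrt {ι : Type*} [Fintype ι] (b : OrthonormalBasis ι ℂ E) {P : ℝ → E →L[ℂ] E}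
    (hP : AEStronglyMeasurable P circ) (hpos : ∀ᵐ s ∂circ, (P s).IsPositive)
    (htr : ∫⁻ s, ∑ k, ENNReal.ofReal (inner ℂ (b k) (P s (b k))).re ∂circ ≠ ⊤) :
    MemLp (fun s => CFC.sqrt (P s)) 2 circ := by
  have hm := aestronglyMeasurable_sqrt hP hpos
  refine memLp_two_of_integrable_sq_norm hm ⟨hm.norm.pow 2, ?_⟩
  rw [hasFiniteIntegral_iff_ofReal (Eventually.of_forall fun s => sq_nonneg _)]
  refine lt_of_le_of_lt (lintegral_mono_ae ?_) (lt_top_iff_ne_top.2 htr)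
  filter_upwards [hpos] with s hs
  rw [← ENNReal.ofReal_sum_of_nonneg (f := fun k => (inner ℂ (b k) (P s (b k))).re)
    fun k _ => hs.re_inner_nonneg_right _]
  exact ENNReal.ofReal_le_ofReal (sq_norm_sqrt_le_trace b hs)

theorem exists_isDensityPair {ι : Type*} [Fintype ι] (b : OrthonormalBasis ι ℂ E)
    {F G : ℝ → E →L[ℂ] E} (hF : AEStronglyMeasurable F circ) (hG : AEStronglyMeasurable G circ)
    (hFpos : ∀ᵐ s ∂circ, (F s).IsPositive) (hGpos : ∀ᵐ s ∂circ, (G s).IsPositive)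
    (hu : ∀ᵐ s ∂circ, IsUnit (F s + G s))
    (htr : ∫⁻ s, ∑ k, ENNReal.ofReal (inner ℂ (b k) ((F s + G s) (b k))).re ∂circ ≠ ⊤)
    (htri : ∫⁻ s, ∑ k, ENNReal.ofReal (inner ℂ (b k) (Ring.inverse (F s + G s) (b k))).re ∂circ
      ≠ ⊤) : ∃ T S, IsDensityPair F G T S := by
  have hPpos : ∀ᵐ s ∂circ, (F s + G s).IsPositive := by
    filter_upwards [hFpos, hGpos] with s h1 h2 using h1.add h2
  have hinv : ∀ᵐ s ∂circ, Ring.inverse (F s + G s)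
      = CFC.sqrt (Ring.inverse (F s + G s)) * CFC.sqrt (Ring.inverse (F s + G s)) := by
    filter_upwards [hPpos, hu] with s hs hus
    have hs' : 0 ≤ F s + G s := (ContinuousLinearMap.nonneg_iff_isPositive _).2 hs
    have hsu := (CFC.isUnit_sqrt_iff (F s + G s) hs').2 hus
    rw [CFC.sqrt_ringInverse]
    conv_lhs => rw [← CFC.sqrt_mul_sqrt_self (F s + G s) hs']
    exact Ring.mul_inverse_rev' (Commute.refl _)
  have hinvpos : ∀ᵐ s ∂circ, (Ring.inverse (F s + G s)).IsPositive := by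
    filter_upwards [hinv] with s hs
    have hsym : (CFC.sqrt (Ring.inverse (F s + G s))).IsPositive :=
      (ContinuousLinearMap.nonneg_iff_isPositive _).1 (CFC.sqrt_nonneg _)
    rw [hs, ← ContinuousLinearMap.nonneg_iff_isPositive]
    have h0 := CFC.sqrt_nonneg (Ring.inverse (F s + G s))
    exact (IsSelfAdjoint.of_nonneg h0).mul_self_nonneg
  have hsymm : ∀ X : E →L[ℂ] E, ∀ x y, inner ℂ (CFC.sqrt X x) y = inner ℂ x (CFC.sqrt X y) :=
    fun X => ((ContinuousLinearMap.nonneg_iff_isPositive _).1 (CFC.sqrt_nonneg X)).isSymmetric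
  refine ⟨fun s => CFC.sqrt (F s + G s), fun s => CFC.sqrt (Ring.inverse (F s + G s)),
    { memLp := memLp_sqrt b (hF.add hG) hPpos htr
      memLp_inv := memLp_sqrt b (aestronglyMeasurable_inverse (hF.add hG) hu) hinvpos htri
      symm := Eventually.of_forall fun s => hsymm _
      symm_inv := Eventually.of_forall fun s => hsymm _
      apply_inv := ?_
      inv_apply := ?_
      meas_left := hF
      meas_right := hG
      pos_left := hFpos
      pos_right := hGpos
      mul_self := ?_
      inverse_eq := hinv }⟩
  · filter_upwards [hPpos, hu] with s hs hus x
    have hs' : 0 ≤ F s + G s := (ContinuousLinearMap.nonneg_iff_isPositive _).2 hs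
    rw [CFC.sqrt_ringInverse]
    exact congrArg (fun X : E →L[ℂ] E => X x)
      (Ring.mul_inverse_cancel _ ((CFC.isUnit_sqrt_iff (F s + G s) hs').2 hus))
  · filter_upwards [hPpos, hu] with s hs hus x
    have hs' : 0 ≤ F s + G s := (ContinuousLinearMap.nonneg_iff_isPositive _).2 hs
    rw [CFC.sqrt_ringInverse]
    exact congrArg (fun X : E →L[ℂ] E => X x)
      (Ring.inverse_mul_cancel _ ((CFC.isUnit_sqrt_iff (F s + G s) hs').2 hus))
  · filter_upwards [hPpos] with s hs
    exact CFC.sqrt_mul_sqrt_self _ ((ContinuousLinearMap.nonneg_iff_isPositive _).2 hs)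

end

section

variable {E : Type*} [NormedAddCommGroup E] [InnerProductSpace ℂ E]

/-! ### The error of an estimate, at a fixed frequency -/

/-- Complete the square in `T h`, using ⟨T h, S F a⟩ = ⟨h, F a⟩. The remainder ⟨a, F a⟩ - ‖S F a‖²
is the residual because G = T² - F. -/
theorem re_inner_error_eq {F G T S : E →L[ℂ] E} (hF : F.IsPositive)
    (hT : ∀ x y, inner ℂ (T x) y = inner ℂ x (T y)) (hS : ∀ x y, inner ℂ (S x) y = inner ℂ x (S y))
    (hTS : ∀ x, T (S x) = x) (hTT : T * T = F + G) (a h : E) :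
    (inner ℂ (a - h) (F (a - h))).re + (inner ℂ h (G h)).re
      = ‖T h - S (F a)‖ ^ 2 + (inner ℂ a (G (S (S (F a))))).re := by
  have hFs : ∀ x y, inner ℂ (F x) y = inner ℂ x (F y) := fun x y => hF.isSymmetric x y
  have hP : ∀ x, T (T x) = F x + G x := fun x =>
    congrArg (fun X : E →L[ℂ] E => X x) hTT
  have h1 : inner ℂ h (G h) = inner ℂ (T h) (T h) - inner ℂ h (F h) := by
    rw [hT, hP, inner_add_right]; ring
  have h2 : inner ℂ a (G (S (S (F a)))) = inner ℂ a (F a) - inner ℂ (S (F a)) (S (F a)) := by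
    have : G (S (S (F a))) = F a - F (S (S (F a))) := by
      rw [eq_sub_iff_add_eq', ← hP, hTS, hTS]
    rw [this, inner_sub_right, hS, ← hFs a (S (S (F a)))]
  have h3 : inner ℂ (T h) (S (F a)) = inner ℂ h (F a) := by rw [hT, hTS]
  have h4 : (inner ℂ a (F h)).re = (inner ℂ h (F a)).re := by
    rw [← hFs, ← inner_conj_symm, Complex.conj_re]
  have h5 := norm_sub_sq (𝕜 := ℂ) (T h) (S (F a))
  have h6 := inner_self_eq_norm_sq (𝕜 := ℂ) (T h)
  have h7 := inner_self_eq_norm_sq (𝕜 := ℂ) (S (F a))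
  simp only [RCLike.re_to_complex] at h5 h6 h7
  rw [h5, h1, h2, h3, ← h6, ← h7]
  simp only [map_sub, inner_sub_left, inner_sub_right, Complex.sub_re, h4]
  ring

/-- The residual is the error of the estimate h = S² F a, for which the square vanishes. -/
theorem re_inner_residual_nonneg {F G T S : E →L[ℂ] E} (hF : F.IsPositive) (hG : G.IsPositive)
    (hT : ∀ x y, inner ℂ (T x) y = inner ℂ x (T y)) (hS : ∀ x y, inner ℂ (S x) y = inner ℂ x (S y))
    (hTS : ∀ x, T (S x) = x) (hTT : T * T = F + G) (a : E) :
    0 ≤ (inner ℂ a (G (S (S (F a))))).re := by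
  have h := re_inner_error_eq hF hT hS hTS hTT a (S (S (F a)))
  rw [hTS, sub_self, norm_zero, zero_pow two_ne_zero, zero_add] at h
  rw [← h]
  exact add_nonneg (hF.re_inner_nonneg_right _) (hG.re_inner_nonneg_right _)

/-- `S F S` and `S G S` are nonnegative with sum 1. This contraction bound compensates for `F` and
`G` being unbounded as functions of the frequency. -/
theorem opNorm_compress_le_one [CompleteSpace E] {F G T S : E →L[ℂ] E} (hF : F.IsPositive) (hG : G.IsPositive)
    (hS : ∀ x y, inner ℂ (S x) y = inner ℂ x (S y))
    (hTS : ∀ x, T (S x) = x) (hST : ∀ x, S (T x) = x) (hTT : T * T = F + G) :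
    ‖S * F * S‖ ≤ 1 := by
  have hSad : ContinuousLinearMap.adjoint S = S :=
    (ContinuousLinearMap.eq_adjoint_iff S S).2 hS ▸ rfl
  have hpos : ∀ {X : E →L[ℂ] E}, X.IsPositive → 0 ≤ S * X * S := fun {X} hX => by
    rw [ContinuousLinearMap.nonneg_iff_isPositive]
    have := hX.conj_adjoint S
    rwa [hSad] at this
  have hone : S * F * S + S * G * S = 1 := by
    rw [← add_mul, ← mul_add, ← hTT]
    ext x
    simp [hTS, hST]
  have hle : S * F * S ≤ 1 := by
    rw [← hone]
    exact le_add_of_nonneg_right (hpos hG)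
  exact (CStarAlgebra.norm_le_norm_of_nonneg_of_le (hpos hF) hle).trans
    ContinuousLinearMap.norm_id_le

end

/-! ### The estimation problem for one component -/

theorem lintegral_norm_sq_eq {E : Type*} [NormedAddCommGroup E] [InnerProductSpace ℂ E]
    (f : Lp E 2 circ) :
    ∫⁻ s, ENNReal.ofReal (‖(f : ℝ → E) s‖ ^ 2) ∂circ = ENNReal.ofReal (‖f‖ ^ 2) := by
  have hf : MemLp (f : ℝ → E) 2 circ := Lp.memLp f
  rw [norm_sq_eq_integral, ofReal_integral_eq_lintegral_ofReal
    ((memLp_two_iff_integrable_sq_norm hf.1).1 hf) (Eventually.of_forall fun s => sq_nonneg _)]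

section

variable {E : Type*} [NormedAddCommGroup E] [InnerProductSpace ℂ E] [CompleteSpace E]
  {F G T S : ℝ → E →L[ℂ] E}

instance {ι : Type*} (hT : MemLp T 2 circ) (b : ι → E) :
    (pastSpace hT b).HasOrthogonalProjection := by
  unfold pastSpace
  infer_instance

theorem IsDensityPair.ae_norm_le (h : IsDensityPair F G T S) :
    ∀ᵐ s ∂circ, ‖S s * F s * S s‖ ≤ 1 ∧ ‖S s * G s * S s‖ ≤ 1 := by
  filter_upwards [h.symm_inv, h.apply_inv, h.inv_apply, h.pos_left, h.pos_right, h.mul_self]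
    with s h1 h2 h3 h4 h5 h6
  exact ⟨opNorm_compress_le_one h4 h5 h1 h2 h3 h6,
    opNorm_compress_le_one h5 h4 h1 h2 h3 (by rw [h6, add_comm])⟩

theorem IsDensityPair.memLp_response (h : IsDensityPair F G T S) {A : ℝ → E}
    (hA : AEStronglyMeasurable A circ) {C : ℝ} (hC : ∀ s, ‖A s‖ ≤ C) :
    MemLp (fun s => S s (F s (A s))) 2 circ := by
  have hm : AEStronglyMeasurable (fun s => S s (F s (A s))) circ :=
    aestronglyMeasurable_apply h.memLp_inv.1 (aestronglyMeasurable_apply h.meas_left hA)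
  refine h.memLp.of_le_mul (c := C) hm ?_
  filter_upwards [h.ae_norm_le, h.inv_apply] with s h1 h2
  -- Inserting `S T = 1` isolates the contraction and leaves only `T A`, which is square integrable.
  have : S s (F s (A s)) = (S s * F s * S s) (T s (A s)) :=
    congrArg (fun y => S s (F s y)) (h2 (A s)).symm
  rw [this, mul_comm]
  calc ‖(S s * F s * S s) (T s (A s))‖ ≤ 1 * ‖T s (A s)‖ := (S s * F s * S s).le_of_opNorm_le h1.1 _
    _ ≤ ‖T s‖ * C := by rw [one_mul]; exact (T s).le_opNorm_of_le (hC s)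

theorem IsDensityPair.integrable_gain (h : IsDensityPair F G T S) :
    Integrable (fun s => S s * S s * F s) circ := by
  refine Integrable.mono' (h.memLp_inv.norm.integrable_mul h.memLp.norm)
    ((h.memLp_inv.1.mul h.memLp_inv.1).mul h.meas_left) ?_
  filter_upwards [h.ae_norm_le, h.inv_apply] with s h1 h2
  have : S s * S s * F s = S s * (S s * F s * S s) * T s := by
    ext x
    exact congrArg (fun y => S s (S s (F s y))) (h2 x).symm
  rw [this]
  calc ‖S s * (S s * F s * S s) * T s‖ ≤ ‖S s‖ * ‖S s * F s * S s‖ * ‖T s‖ := by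
        refine (norm_mul_le _ _).trans ?_
        gcongr
        exact norm_mul_le _ _
    _ ≤ ‖S s‖ * 1 * ‖T s‖ := by gcongr; exact h1.1
    _ = _ := by simp

theorem IsDensityPair.integrable_residual (h : IsDensityPair F G T S) :
    Integrable (fun s => G s * (S s * S s) * F s) circ := by
  refine Integrable.mono' ((memLp_two_iff_integrable_sq_norm h.memLp.1).1 h.memLp)
    ((h.meas_right.mul (h.memLp_inv.1.mul h.memLp_inv.1)).mul h.meas_left) ?_
  filter_upwards [h.ae_norm_le, h.inv_apply, h.apply_inv] with s h1 h2 h3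
  -- Two contractions between two factors `T` bound the residual operator by ‖T‖².
  have : G s * (S s * S s) * F s = T s * (S s * G s * S s) * (S s * F s * S s) * T s := by
    ext x
    change G s (S s (S s (F s x))) = T s (S s (G s (S s (S s (F s (S s (T s x)))))))
    rw [h2, h3]
  rw [this]
  calc ‖T s * (S s * G s * S s) * (S s * F s * S s) * T s‖
      ≤ ‖T s‖ * ‖S s * G s * S s‖ * ‖S s * F s * S s‖ * ‖T s‖ := by
        refine (norm_mul_le _ _).trans ?_
        gcongr
        refine (norm_mul_le _ _).trans ?_
        gcongr
        exact norm_mul_le _ _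
    _ ≤ ‖T s‖ * 1 * 1 * ‖T s‖ := by gcongr; exacts [h1.2, h1.1]
    _ = _ := by ring

/-- The error of the estimate `h` is the distance of `T h` to `T⁻¹ F A`, plus a residual which does
not depend on `h`. -/
theorem IsDensityPair.lintegral_error (h : IsDensityPair F G T S) {A : ℝ → E}
    (hA : AEStronglyMeasurable A circ) (y : ℝ → E) :
    ∫⁻ s, (ENNReal.ofReal (inner ℂ (A s - y s) (F s (A s - y s))).re
      + ENNReal.ofReal (inner ℂ (y s) (G s (y s))).re) ∂circ
    = ∫⁻ s, ENNReal.ofReal (‖T s (y s) - S s (F s (A s))‖ ^ 2) ∂circ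
      + ∫⁻ s, ENNReal.ofReal (inner ℂ (A s) ((G s * (S s * S s) * F s) (A s))).re ∂circ := by
  have hm : AEStronglyMeasurable (fun s => (inner ℂ (A s) ((G s * (S s * S s) * F s) (A s)))) circ :=
    hA.inner (aestronglyMeasurable_apply
      ((h.meas_right.mul (h.memLp_inv.1.mul h.memLp_inv.1)).mul h.meas_left) hA)
  rw [← lintegral_add_right' _
    (Complex.continuous_re.comp_aestronglyMeasurable hm).aemeasurable.ennreal_ofReal]
  refine lintegral_congr_ae ?_
  filter_upwards [h.symm, h.symm_inv, h.apply_inv, h.pos_left, h.pos_right, h.mul_self]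
    with s h1 h2 h3 h4 h5 h6
  have h7 : 0 ≤ (inner ℂ (A s - y s) (F s (A s - y s))).re := h4.re_inner_nonneg_right _
  have h8 : 0 ≤ (inner ℂ (y s) (G s (y s))).re := h5.re_inner_nonneg_right _
  have h9 : 0 ≤ (inner ℂ (A s) ((G s * (S s * S s) * F s) (A s))).re :=
    re_inner_residual_nonneg h4 h5 h1 h2 h3 h6 (A s)
  rw [← ENNReal.ofReal_add h7 h8, ← ENNReal.ofReal_add (sq_nonneg _) h9]
  exact congrArg _ (re_inner_error_eq h4 h1 h2 h3 h6 (A s) (y s))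

theorem IsDensityPair.le_lintegral_dist {ι : Type*} (b : ι → E)
    (h : IsDensityPair F G T S) {A : ℝ → E} (hA : AEStronglyMeasurable A circ) {C : ℝ}
    (hC : ∀ s, ‖A s‖ ≤ C) {y : ℝ → E} (hy : MemLp (fun s => T s (y s)) 2 circ)
    (hyN : hy.toLp _ ∈ pastSpace h.memLp b) :
    ENNReal.ofReal (‖(h.memLp_response hA hC).toLp _
        - (pastSpace h.memLp b).starProjection ((h.memLp_response hA hC).toLp _)‖ ^ 2)
      ≤ ∫⁻ s, ENNReal.ofReal (‖T s (y s) - S s (F s (A s))‖ ^ 2) ∂circ := by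
  set U := (h.memLp_response hA hC).toLp _ with hU
  have h1 : ∫⁻ s, ENNReal.ofReal (‖T s (y s) - S s (F s (A s))‖ ^ 2) ∂circ
      = ENNReal.ofReal (‖hy.toLp _ - U‖ ^ 2) := by
    rw [← lintegral_norm_sq_eq]
    refine lintegral_congr_ae ?_
    filter_upwards [hy.coeFn_toLp, (h.memLp_response hA hC).coeFn_toLp,
      Lp.coeFn_sub (hy.toLp _) U] with s h1 h2 h3
    rw [h3, Pi.sub_apply, h1, h2]
  rw [h1]
  refine ENNReal.ofReal_le_ofReal ?_
  gcongr
  rw [norm_sub_rev (hy.toLp _) U, Submodule.starProjection_minimal]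
  exact ciInf_le ⟨0, by rintro _ ⟨x, rfl⟩; exact norm_nonneg _⟩
    (⟨hy.toLp _, hyN⟩ : pastSpace h.memLp b)

theorem IsDensityPair.exists_lintegral_dist_eq {ι : Type*} (b : ι → E)
    (h : IsDensityPair F G T S) {A : ℝ → E} (hA : AEStronglyMeasurable A circ) {C : ℝ}
    (hC : ∀ s, ‖A s‖ ≤ C) :
    ∃ (y : ℝ → E) (_ : AEStronglyMeasurable y circ) (hy : MemLp (fun s => T s (y s)) 2 circ),
      hy.toLp _ ∈ pastSpace h.memLp b ∧
      ∫⁻ s, ENNReal.ofReal (‖T s (y s)‖ ^ 2) ∂circ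
        ≤ ∫⁻ s, ENNReal.ofReal (inner ℂ (A s) (F s (A s))).re ∂circ ∧
      ∫⁻ s, ENNReal.ofReal (‖T s (y s) - S s (F s (A s))‖ ^ 2) ∂circ
        = ENNReal.ofReal (‖(h.memLp_response hA hC).toLp _
          - (pastSpace h.memLp b).starProjection ((h.memLp_response hA hC).toLp _)‖ ^ 2) := by
  set U := (h.memLp_response hA hC).toLp _ with hU
  set Q : Lp E 2 circ := (pastSpace h.memLp b).starProjection U with hQ
  have hQL : MemLp (Q : ℝ → E) 2 circ := Lp.memLp Q
  have hae : (fun s => T s (S s ((Q : ℝ → E) s))) =ᵐ[circ] (Q : ℝ → E) := by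
    filter_upwards [h.apply_inv] with s hs using hs _
  have hmem : MemLp (fun s => T s (S s ((Q : ℝ → E) s))) 2 circ := (memLp_congr_ae hae).2 hQL
  -- The optimal characteristic is `S Q`, where `Q` is the projection of the response onto the past,
  -- so that `T y = Q`.
  refine ⟨fun s => S s ((Q : ℝ → E) s), aestronglyMeasurable_apply h.memLp_inv.1 hQL.1, hmem, ?_, ?_, ?_⟩
  · have : hmem.toLp _ = Q := by
      exact ((MemLp.toLp_eq_toLp_iff hmem hQL).2 hae).trans (Lp.toLp_coeFn Q hQL)
    rw [this]
    exact Submodule.starProjection_apply_mem _ _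
  · have h1 : ∫⁻ s, ENNReal.ofReal (‖T s (S s ((Q : ℝ → E) s))‖ ^ 2) ∂circ
        = ENNReal.ofReal (‖Q‖ ^ 2) := by
      rw [← lintegral_norm_sq_eq]
      refine lintegral_congr_ae ?_
      filter_upwards [hae] with s hs
      rw [hs]
    have h2 : ENNReal.ofReal (‖Q‖ ^ 2) ≤ ENNReal.ofReal (‖U‖ ^ 2) := by
      refine ENNReal.ofReal_le_ofReal ?_
      gcongr
      exact Submodule.norm_starProjection_apply_le _ _
    rw [h1]
    refine h2.trans ?_
    rw [← lintegral_norm_sq_eq]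
    refine lintegral_mono_ae ?_
    filter_upwards [(h.memLp_response hA hC).coeFn_toLp, h.symm, h.symm_inv, h.apply_inv,
      h.pos_left, h.pos_right, h.mul_self] with s h0 h1 h2 h3 h4 h5 h6
    rw [h0]
    refine ENNReal.ofReal_le_ofReal ?_
    -- The zero estimate has error ⟨A, F A⟩, which therefore dominates ‖S F A‖².
    have h7 := re_inner_error_eq h4 h1 h2 h3 h6 (A s) 0
    have h8 := re_inner_residual_nonneg h4 h5 h1 h2 h3 h6 (A s)
    simp only [sub_zero, inner_zero_left, Complex.zero_re, add_zero, map_zero, zero_sub,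
      norm_neg] at h7
    linarith
  · rw [norm_sub_rev, ← lintegral_norm_sq_eq]
    refine lintegral_congr_ae ?_
    filter_upwards [hae, (h.memLp_response hA hC).coeFn_toLp, Lp.coeFn_sub Q U] with s h1 h2 h3
    rw [h3, Pi.sub_apply, h1, h2]


end

/-! ### Fourier expansions -/

section

variable {E : Type*} [NormedAddCommGroup E] [InnerProductSpace ℂ E] {ι : Type*} [Fintype ι]

theorem summable_norm_coord (b : OrthonormalBasis ι ℂ E) {a : ℕ → E}
    (ha : Summable fun j => ‖a j‖) :
    Summable fun p : ℕ × ι => ‖inner ℂ (b p.2) (a p.1)‖ := by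
  rw [summable_prod_of_nonneg fun p => norm_nonneg _]
  refine ⟨fun j => Summable.of_finite, ?_⟩
  simp only [tsum_fintype]
  refine (ha.mul_left (Fintype.card ι : ℝ)).of_nonneg_of_le
    (fun j => Finset.sum_nonneg fun k _ => norm_nonneg _) fun j => ?_
  calc ∑ k, ‖inner ℂ (b k) (a j)‖ ≤ ∑ _k : ι, ‖a j‖ := Finset.sum_le_sum fun k _ => by
        refine (norm_inner_le_norm _ _).trans ?_
        rw [b.norm_eq_one, one_mul]
    _ = _ := by simp

theorem hasSum_coord_smul_trig [CompleteSpace E] (b : OrthonormalBasis ι ℂ E) {a : ℕ → E}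
    (ha : Summable fun j => ‖a j‖) (s : ℝ) :
    HasSum (fun p : ℕ × ι => inner ℂ (b p.2) (a p.1) • trig (p.1 : ℤ) (b p.2) s)
      (∑' j : ℕ, trig (j : ℤ) (a j) s) := by
  have hs : Summable fun p : ℕ × ι => inner ℂ (b p.2) (a p.1) • trig (p.1 : ℤ) (b p.2) s := by
    refine Summable.of_norm ?_
    simpa only [norm_smul, norm_trig, b.norm_eq_one, mul_one] using summable_norm_coord b ha
  convert hs.hasSum using 1
  rw [hs.tsum_prod]
  congr 1
  funext j
  rw [tsum_fintype]
  conv_lhs => rw [← b.sum_repr' (a j)]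
  simp only [trig, Finset.smul_sum]
  exact Finset.sum_congr rfl fun k _ => smul_comm _ _ _

theorem norm_tsum_trig_le {a : ℕ → E} (ha : Summable fun j => ‖a j‖) (s : ℝ) :
    ‖∑' j : ℕ, trig (j : ℤ) (a j) s‖ ≤ ∑' j, ‖a j‖ := by
  have h : Summable fun j : ℕ => ‖trig (j : ℤ) (a j) s‖ := by simpa only [norm_trig] using ha
  simpa only [norm_trig] using norm_tsum_le_tsum_norm h

theorem continuous_tsum_trig [CompleteSpace E] {a : ℕ → E} (ha : Summable fun j => ‖a j‖) :
    Continuous fun s => ∑' j : ℕ, trig (j : ℤ) (a j) s :=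
  continuous_tsum (fun _ => continuous_trig _ _) ha fun _ s => (norm_trig _ _ s).le

theorem integrable_apply_of_bound {X : ℝ → E →L[ℂ] E} (hX : Integrable X circ) {y : ℝ → E}
    (hy : AEStronglyMeasurable y circ) {C : ℝ} (hC : ∀ s, ‖y s‖ ≤ C) :
    Integrable (fun s => X s (y s)) circ := by
  refine (hX.norm.mul_const C).mono' (aestronglyMeasurable_apply hX.1 hy)
    (Eventually.of_forall fun s => ?_)
  exact (X s).le_opNorm_of_le (hC s)

theorem integrable_inner_of_bound {y z : ℝ → E} (hz : Integrable z circ)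
    (hy : AEStronglyMeasurable y circ) {C : ℝ} (hC : ∀ s, ‖y s‖ ≤ C) :
    Integrable (fun s => inner ℂ (y s) (z s)) circ := by
  refine (hz.norm.const_mul C).mono' (hy.inner hz.1) (Eventually.of_forall fun s => ?_)
  refine (norm_inner_le_norm _ _).trans ?_
  gcongr
  exact hC s

/-- Absolute summability of the coefficients and integrability of ‖X‖ allow summation under the
integral; this evaluates an infinite matrix acting on the coefficient sequence. -/
theorem hasSum_mul_integral_right [CompleteSpace E] (b : OrthonormalBasis ι ℂ E) {a : ℕ → E}
    (ha : Summable fun j => ‖a j‖) {X : ℝ → E →L[ℂ] E} (hX : Integrable X circ) (i : ℤ) (x : E) :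
    HasSum (fun p : ℕ × ι =>
        (∫ s, inner ℂ (trig i x s) (X s (trig (p.1 : ℤ) (b p.2) s)) ∂circ) * inner ℂ (b p.2) (a p.1))
      (∫ s, inner ℂ (trig i x s) (X s (∑' j : ℕ, trig (j : ℤ) (a j) s)) ∂circ) := by
  have hint : ∀ p : ℕ × ι, Integrable (fun s =>
      inner ℂ (trig i x s) (X s (trig (p.1 : ℤ) (b p.2) s)) * inner ℂ (b p.2) (a p.1)) circ :=
    fun p => (integrable_inner_of_bound (integrable_apply_of_bound hX
      (continuous_trig _ _).aestronglyMeasurable fun s => (norm_trig _ _ s).le)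
      (continuous_trig _ _).aestronglyMeasurable fun s => (norm_trig _ _ s).le).mul_const _
  have hsum : Summable fun p : ℕ × ι => ∫ s,
      ‖inner ℂ (trig i x s) (X s (trig (p.1 : ℤ) (b p.2) s)) * inner ℂ (b p.2) (a p.1)‖ ∂circ := by
    refine ((summable_norm_coord b ha).mul_left (∫ s, ‖x‖ * ‖X s‖ ∂circ)).of_nonneg_of_le
      (fun p => integral_nonneg fun s => norm_nonneg _) fun p => ?_
    rw [← integral_mul_const]
    refine integral_mono (hint p).norm ((hX.norm.const_mul _).mul_const _) fun s => ?_
    simp only [norm_mul]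
    gcongr
    refine (norm_inner_le_norm _ _).trans ?_
    rw [norm_trig]
    gcongr
    refine (X s).le_opNorm_of_le ?_ |>.trans (mul_one _).le
    rw [norm_trig, b.norm_eq_one]
  have key := hasSum_integral_of_summable_integral_norm hint hsum
  simp only [integral_mul_const] at key
  refine (congrArg (HasSum _) (integral_congr_ae (Eventually.of_forall fun s => ?_))).mp key
  have h1 := ((hasSum_coord_smul_trig b ha s).mapL (X s)).mapL (innerSL ℂ (trig i x s))
  refine Eq.trans (tsum_congr fun p => ?_) h1.tsum_eq
  simp [mul_comm]

theorem hasSum_conj_mul_integral_left [CompleteSpace E] (b : OrthonormalBasis ι ℂ E) {a : ℕ → E}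
    (ha : Summable fun j => ‖a j‖) {Y : ℝ → E} (hY : Integrable Y circ) :
    HasSum (fun q : ℕ × ι =>
        conj (inner ℂ (b q.2) (a q.1)) * ∫ s, inner ℂ (trig (q.1 : ℤ) (b q.2) s) (Y s) ∂circ)
      (∫ s, inner ℂ (∑' j : ℕ, trig (j : ℤ) (a j) s) (Y s) ∂circ) := by
  have hint : ∀ q : ℕ × ι, Integrable (fun s =>
      conj (inner ℂ (b q.2) (a q.1)) * inner ℂ (trig (q.1 : ℤ) (b q.2) s) (Y s)) circ :=
    fun q => (integrable_inner_of_bound hY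
      (continuous_trig _ _).aestronglyMeasurable fun s => (norm_trig _ _ s).le).const_mul _
  have hsum : Summable fun q : ℕ × ι => ∫ s,
      ‖conj (inner ℂ (b q.2) (a q.1)) * inner ℂ (trig (q.1 : ℤ) (b q.2) s) (Y s)‖ ∂circ := by
    refine ((summable_norm_coord b ha).mul_right (∫ s, ‖Y s‖ ∂circ)).of_nonneg_of_le
      (fun p => integral_nonneg fun s => norm_nonneg _) fun q => ?_
    rw [← integral_const_mul]
    refine integral_mono (hint q).norm (hY.norm.const_mul _) fun s => ?_
    simp only [norm_mul, RCLike.norm_conj]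
    gcongr
    refine (norm_inner_le_norm _ _).trans ?_
    rw [norm_trig, b.norm_eq_one, one_mul]
  have key := hasSum_integral_of_summable_integral_norm hint hsum
  simp only [integral_const_mul] at key
  refine (congrArg (HasSum _) (integral_congr_ae (Eventually.of_forall fun s => ?_))).mp key
  have h1 := (((hasSum_coord_smul_trig b ha s).mapL (innerSL ℂ (Y s))).star)
  simp only [innerSL_apply_apply, RCLike.star_def, inner_conj_symm] at h1
  refine Eq.trans (tsum_congr fun p => ?_) h1.tsum_eq
  rw [inner_smul_left]

end

/-! ### The matrices of the extrapolation problem -/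

section

variable {K : Type*}

theorem basisVec_apply [DecidableEq K] (k l : K) : (basisVec k : Ell K) l = if k = l then 1 else 0 := by
  by_cases h : k = l
  · subst h; simp [basisVec]
  · simp [basisVec, h, Ne.symm h]

theorem orthonormal_basisVec : Orthonormal ℂ (basisVec : K → Ell K) := by
  classical
  rw [orthonormal_iff_ite]
  intro i j
  rw [inner_basisVec, basisVec_apply]
  simp only [eq_comm]

theorem fourierEntry_eq (X : ℝ → (Ell K →L[ℂ] Ell K)) (p : ℤ) (k' k : K) :
    fourierEntry X p k' k
      = (2 * (Real.pi : ℂ))⁻¹ * ∫ s, expo p s * inner ℂ (basisVec k') (X s (basisVec k)) ∂circ := by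
  rw [fourierEntry, one_div, circ, integral_Ico_eq_integral_Ioo, ← integral_Ioc_eq_integral_Ioo,
    intervalIntegral.integral_of_le (by linarith [Real.pi_pos])]
  rfl

theorem symbolA_eq {n : ℕ} (a : HIndex n → ℕ → Ell K) (i : HIndex n) (s : ℝ) :
    symbolA a i s = ∑' j : ℕ, trig (j : ℤ) (a i j) s := by
  simp [symbolA, trig, expo]

variable [Fintype K]

/-- The standard basis as an orthonormal basis. -/
noncomputable def stdBasis (K : Type*) [Fintype K] : OrthonormalBasis K ℂ (Ell K) :=
  OrthonormalBasis.mkOfOrthogonalEqBot orthonormal_basisVec (by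
    rw [Submodule.eq_bot_iff]
    intro y hy
    apply lp.ext
    funext k
    rw [← inner_basisVec]
    exact (Submodule.mem_orthogonal _ _).1 hy _ (Submodule.subset_span (mem_range_self k)))

theorem stdBasis_apply (k : K) : stdBasis K k = basisVec k := by
  simp [stdBasis]

theorem finiteDimensional_ell : FiniteDimensional ℂ (Ell K) :=
  Module.Finite.of_basis (stdBasis K).toBasis

theorem inner_stdBasis (k : K) (y : Ell K) : inner ℂ (stdBasis K k) y = y k := by
  rw [stdBasis_apply, inner_basisVec]

theorem toeplitz_eq (X : ℝ → (Ell K →L[ℂ] Ell K)) (q p : ℕ × K) :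
    toeplitz X q p = (2 * (Real.pi : ℂ))⁻¹ * ∫ s, inner ℂ (trig (q.1 : ℤ) (stdBasis K q.2) s)
      (X s (trig (p.1 : ℤ) (stdBasis K p.2) s)) ∂circ := by
  rw [toeplitz, fourierEntry_eq]
  congr 2
  funext s
  rw [inner_trig_left, trig, map_smul, inner_smul_right, stdBasis_apply, stdBasis_apply,
    sub_eq_neg_add, expo_add]
  ring

theorem matAct_toeplitz {n : ℕ} {a : HIndex n → ℕ → Ell K} {i : HIndex n}
    (ha : Summable fun j => ‖a i j‖) {X : ℝ → (Ell K →L[ℂ] Ell K)} (hX : Integrable X circ)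
    (q : ℕ × K) :
    matAct (toeplitz X) (vecA a i) q = (2 * (Real.pi : ℂ))⁻¹ *
      ∫ s, inner ℂ (trig (q.1 : ℤ) (stdBasis K q.2) s) (X s (symbolA a i s)) ∂circ := by
  simp only [symbolA_eq]
  rw [← (hasSum_mul_integral_right (stdBasis K) ha hX (q.1 : ℤ) (stdBasis K q.2)).tsum_eq,
    ← tsum_mul_left]
  simp only [matAct, toeplitz_eq, vecA, inner_stdBasis, mul_assoc]

theorem pairing_matAct_toeplitz {n : ℕ} {a : HIndex n → ℕ → Ell K} {i : HIndex n}
    (ha : Summable fun j => ‖a i j‖) {X : ℝ → (Ell K →L[ℂ] Ell K)} (hX : Integrable X circ) :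
    (pairing (vecA a i) (matAct (toeplitz X) (vecA a i))).re = (2 * Real.pi)⁻¹ *
      (∫ s, inner ℂ (symbolA a i s) (X s (symbolA a i s)) ∂circ).re := by
  have hA : Integrable (fun s => X s (symbolA a i s)) circ := by
    simp only [symbolA_eq]
    exact integrable_apply_of_bound hX (continuous_tsum_trig ha).aestronglyMeasurable
      (norm_tsum_trig_le ha)
  have h1 : ∫ s, inner ℂ (symbolA a i s) (X s (symbolA a i s)) ∂circ
      = ∫ s, inner ℂ (∑' j : ℕ, trig (j : ℤ) (a i j) s) (X s (symbolA a i s)) ∂circ := by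
    simp only [← symbolA_eq]
  have h2 := (hasSum_conj_mul_integral_left (stdBasis K) ha hA).mul_left ((2 * (Real.pi : ℂ))⁻¹)
  rw [← h1] at h2
  have h3 := h2.star
  -- `pairing` conjugates its second argument, opposite to the inner product; only the real part
  -- matters, so the conjugate is harmless.
  have h4 : pairing (vecA a i) (matAct (toeplitz X) (vecA a i))
      = conj ((2 * (Real.pi : ℂ))⁻¹
        * ∫ s, inner ℂ (symbolA a i s) (X s (symbolA a i s)) ∂circ) := by
    refine Eq.trans ?_ h3.tsum_eq
    simp only [pairing, matAct_toeplitz ha hX, vecA, inner_stdBasis]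
    congr 1
    funext q
    simp only [RCLike.star_def, map_mul, Complex.conj_conj]
    ring
  rw [h4, Complex.conj_re]
  have : (2 * (Real.pi : ℂ))⁻¹ = (((2 * Real.pi)⁻¹ : ℝ) : ℂ) := by push_cast; rfl
  rw [this, Complex.re_ofReal_mul]

end

section

variable {K : Type*}

theorem toeplitz_congr {X Y : ℝ → (Ell K →L[ℂ] Ell K)} (h : X =ᵐ[circ] Y) :
    toeplitz X = toeplitz Y := by
  funext q p
  rw [toeplitz, toeplitz, fourierEntry_eq, fourierEntry_eq]
  congr 1
  refine integral_congr_ae ?_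
  filter_upwards [h] with s hs
  rw [hs]

/-- The squared distance from the signal to the past is the value of the quadratic form inverse to
the block Toeplitz matrix `B_m`. -/
theorem IsDensityPair.dist_eq_invForm [Fintype K] {n : ℕ} {a : HIndex n → ℕ → Ell K}
    {i : HIndex n} (ha : Summable fun j => ‖a i j‖) {F G : OpFamily K}
    {T S : ℝ → (Ell K →L[ℂ] Ell K)} (h : IsDensityPair (F i.1) (G i.1) T S)
    (hU : MemLp (fun s => S s (F i.1 s (symbolA a i s))) 2 circ) :
    ENNReal.ofReal (1 / (2 * Real.pi)) * ENNReal.ofReal (‖hU.toLp _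
        - (pastSpace h.memLp (stdBasis K)).starProjection (hU.toLp _)‖ ^ 2)
      = invForm (matB F G i.1) (matAct (matD F G i.1) (vecA a i)) := by
  have : FiniteDimensional ℂ (Ell K) := finiteDimensional_ell
  set U := hU.toLp _ with hUdef
  -- The Gram matrix of `f` is 2π times B and its products with `U` are 2π times the entries of D a.
  -- After division by 2π the two variational formulas agree term by term.
  let f : ℕ × K → Lp (Ell K) 2 circ := fun q =>
    (memLp_apply_trig h.memLp_inv (q.1 : ℤ) (stdBasis K q.2)).toLp _
  rw [← iSup_two_mul_re_inner_sub_norm_sq (f := f) (h.orthogonal_pastSpace (stdBasis K)),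
    ENNReal.mul_iSup, invForm]
  have hB : matB F G i.1 = toeplitz fun s => S s * S s := toeplitz_congr h.inverse_eq
  have hD : matD F G i.1 = toeplitz fun s => S s * S s * F i.1 s := by
    refine toeplitz_congr ?_
    filter_upwards [h.inverse_eq] with s hs
    rw [hs]
  have hfU : ∀ q, inner ℂ (f q) U = ∫ s, inner ℂ (trig (q.1 : ℤ) (stdBasis K q.2) s)
      ((S s * S s * F i.1 s) (symbolA a i s)) ∂circ := fun q => by
    rw [inner_toLp_left]
    refine integral_congr_ae ?_
    filter_upwards [hU.coeFn_toLp, h.symm_inv] with s h1 h2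
    rw [h1, h2]
    rfl
  have hff : ∀ q p, inner ℂ (f q) (f p) = ∫ s, inner ℂ (trig (q.1 : ℤ) (stdBasis K q.2) s)
      ((S s * S s) (trig (p.1 : ℤ) (stdBasis K p.2) s)) ∂circ := fun q p => by
    rw [inner_toLp_left]
    refine integral_congr_ae ?_
    filter_upwards [(memLp_apply_trig h.memLp_inv (p.1 : ℤ) (stdBasis K p.2)).coeFn_toLp,
      h.symm_inv] with s h1 h2
    rw [h1, h2]
    rfl
  refine iSup_congr fun x => ?_
  have hlin : Finsupp.linearCombination ℂ f x = ∑ q ∈ x.support, x q • f q := rfl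
  have hpD : pairing (matAct (matD F G i.1) (vecA a i)) x
      = (2 * (Real.pi : ℂ))⁻¹ * inner ℂ (Finsupp.linearCombination ℂ f x) U := by
    rw [pairing, tsum_eq_sum (s := x.support) fun q hq => by
      rw [Finsupp.notMem_support_iff.1 hq, map_zero, mul_zero], hlin, sum_inner, Finset.mul_sum]
    refine Finset.sum_congr rfl fun q _ => ?_
    rw [hD, matAct_toeplitz ha h.integrable_gain, inner_smul_left, hfU]
    ring
  have hact : ∀ q, matAct (matB F G i.1) x q
      = (2 * (Real.pi : ℂ))⁻¹ * inner ℂ (f q) (Finsupp.linearCombination ℂ f x) := fun q => by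
    rw [matAct, tsum_eq_sum (s := x.support) fun q hq => by
      rw [Finsupp.notMem_support_iff.1 hq, mul_zero], hlin, inner_sum, Finset.mul_sum]
    refine Finset.sum_congr rfl fun p _ => ?_
    rw [hB, toeplitz_eq, inner_smul_right, hff]
    ring
  have hpB : pairing (matAct (matB F G i.1) x) x = (2 * (Real.pi : ℂ))⁻¹
      * inner ℂ (Finsupp.linearCombination ℂ f x) (Finsupp.linearCombination ℂ f x) := by
    conv_rhs => arg 2; arg 2; rw [hlin]
    rw [pairing, tsum_eq_sum (s := x.support) fun q hq => by
      rw [Finsupp.notMem_support_iff.1 hq, map_zero, mul_zero], sum_inner, Finset.mul_sum]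
    refine Finset.sum_congr rfl fun q _ => ?_
    rw [hact, inner_smul_left]
    ring
  have hpi : (2 * (Real.pi : ℂ))⁻¹ = (((2 * Real.pi)⁻¹ : ℝ) : ℂ) := by push_cast; rfl
  have hself := inner_self_eq_norm_sq (𝕜 := ℂ) (Finsupp.linearCombination ℂ f x)
  rw [RCLike.re_to_complex] at hself
  rw [← ENNReal.ofReal_mul (by positivity), hpD, hpB, hpi, Complex.re_ofReal_mul,
    Complex.re_ofReal_mul, hself]
  congr 1
  ring

/-- The residual error is the quadratic form of the block Toeplitz matrix `R_m`. -/
theorem IsDensityPair.residual_eq_pairing [Fintype K] {n : ℕ} {a : HIndex n → ℕ → Ell K}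
    {i : HIndex n} (ha : Summable fun j => ‖a i j‖) {F G : OpFamily K}
    {T S : ℝ → (Ell K →L[ℂ] Ell K)} (h : IsDensityPair (F i.1) (G i.1) T S) :
    ENNReal.ofReal (1 / (2 * Real.pi)) * ∫⁻ s, ENNReal.ofReal (inner ℂ (symbolA a i s)
        ((G i.1 s * (S s * S s) * F i.1 s) (symbolA a i s))).re ∂circ
      = ENNReal.ofReal (pairing (vecA a i) (matAct (matR F G i.1) (vecA a i))).re := by
  have hR : matR F G i.1 = toeplitz fun s => G i.1 s * (S s * S s) * F i.1 s := by
    refine toeplitz_congr ?_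
    filter_upwards [h.inverse_eq] with s hs
    rw [hs]
  have hA : ∀ s, ‖symbolA a i s‖ ≤ ∑' j, ‖a i j‖ := fun s => by
    rw [symbolA_eq]; exact norm_tsum_trig_le ha s
  have hAm : AEStronglyMeasurable (symbolA a i) circ := by
    rw [show symbolA a i = _ from funext (symbolA_eq a i)]
    exact (continuous_tsum_trig ha).aestronglyMeasurable
  have hint := integrable_inner_of_bound
    (integrable_apply_of_bound h.integrable_residual hAm hA) hAm hA
  rw [hR, pairing_matAct_toeplitz ha h.integrable_residual, ENNReal.ofReal_mul (by positivity),
    one_div]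
  congr 1
  have hre := integral_re hint
  simp only [RCLike.re_to_complex] at hre
  rw [← hre]
  refine (ofReal_integral_eq_lintegral_ofReal hint.re ?_).symm
  filter_upwards [h.symm, h.symm_inv, h.apply_inv, h.pos_left, h.pos_right, h.mul_self]
    with s h1 h2 h3 h4 h5 h6
  exact re_inner_residual_nonneg h4 h5 h1 h2 h3 h6 (symbolA a i s)

/-! ### Consequences of the minimality condition -/

theorem aemeasurable_posTrace [Countable K] {n : ℕ} {F : OpFamily K}
    (hF : IsSpectralDensity n F) (m : ℕ) : AEMeasurable (fun s => posTrace (F m s)) circ := by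
  unfold posTrace
  exact AEMeasurable.tsum fun k => (Complex.continuous_re.comp_aestronglyMeasurable
    (hF.measurable_entries m k k)).aemeasurable.ennreal_ofReal

/-- Expand ⟨e - y, P (e - y)⟩ ≥ 0 with y = P⁻¹ e: both cross terms equal ‖e‖² = 1. -/
theorem two_le_re_inner_add {E : Type*} [NormedAddCommGroup E] [InnerProductSpace ℂ E]
    {P : E →L[ℂ] E} (hP : P.IsPositive) {e y : E} (hy : P y = e) (he : ‖e‖ = 1) :
    2 ≤ (inner ℂ e (P e)).re + (inner ℂ e y).re := by
  have h0 : 0 ≤ (inner ℂ (e - y) (P (e - y))).re := hP.re_inner_nonneg_right _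
  have h1 : inner ℂ y (P e) = inner ℂ e e := by rw [← hy]; exact (hP.isSymmetric y (P y)).symm
  have h2 : (inner ℂ e e).re = 1 := by
    have := inner_self_eq_norm_sq (𝕜 := ℂ) e
    rw [he, one_pow] at this
    exact this
  have h3 : (inner ℂ y e).re = (inner ℂ e y).re := by rw [← inner_conj_symm, Complex.conj_re]
  rw [map_sub, hy, inner_sub_left, inner_sub_right, inner_sub_right, h1] at h0
  simp only [Complex.sub_re, h2, h3] at h0
  linarith

theorem one_le_add_add_inverse {E : Type*} [NormedAddCommGroup E] [InnerProductSpace ℂ E]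
    {F G : E →L[ℂ] E} (hF : F.IsPositive) (hG : G.IsPositive) (hu : IsUnit (F + G)) {e : E}
    (he : ‖e‖ = 1) :
    1 ≤ ENNReal.ofReal (inner ℂ e (F e)).re + ENNReal.ofReal (inner ℂ e (G e)).re
      + ENNReal.ofReal (inner ℂ e (Ring.inverse (F + G) e)).re := by
  have hinv : (F + G) (Ring.inverse (F + G) e) = e :=
    congrArg (fun X : E →L[ℂ] E => X e) (Ring.mul_inverse_cancel _ hu)
  have h1 := two_le_re_inner_add (hF.add hG) hinv he
  rw [add_apply, inner_add_right, Complex.add_re] at h1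
  have h2 : 1 ≤ (inner ℂ e (F e)).re + (inner ℂ e (G e)).re
      + (inner ℂ e (Ring.inverse (F + G) e)).re := by linarith
  rw [← ENNReal.ofReal_one]
  refine (ENNReal.ofReal_le_ofReal h2).trans (ENNReal.ofReal_add_le.trans ?_)
  gcongr
  exact ENNReal.ofReal_add_le

/-- An invertible operator of trace class exists only in finite dimension. -/
theorem finite_of_minimality [Countable K] {n : ℕ} {F G : OpFamily K}
    (hF : IsSpectralDensity n F) (hG : IsSpectralDensity n G) (hmin : Minimality F G) :
    Finite K := by
  by_contra hinf
  rw [not_finite_iff_infinite] at hinf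
  refine (hmin 0).2 ?_
  -- For infinite `K` the lower bounds over the basis sum to infinity while the traces of F and G
  -- are finite almost everywhere, so the trace of the inverse is infinite.
  have hae : (fun s => posTrace (Ring.inverse (F 0 s + G 0 s))) =ᵐ[circ] fun _ => ⊤ := by
    filter_upwards [hF.positive 0, hG.positive 0, (hmin 0).1,
      ae_lt_top' (aemeasurable_posTrace hF 0) (hF.trace_integrable 0),
      ae_lt_top' (aemeasurable_posTrace hG 0) (hG.trace_integrable 0)] with s h1 h2 h3 h4 h5
    have hk := fun k : K =>
      one_le_add_add_inverse h1 h2 h3 (orthonormal_basisVec.norm_eq_one k)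
    have hsum : (⊤ : ℝ≥0∞) ≤ posTrace (F 0 s) + posTrace (G 0 s)
        + posTrace (Ring.inverse (F 0 s + G 0 s)) := by
      rw [← ENNReal.tsum_const_eq_top_of_ne_zero (α := K) (c := 1) one_ne_zero]
      simp only [posTrace]
      rw [← ENNReal.tsum_add, ← ENNReal.tsum_add]
      exact ENNReal.tsum_le_tsum hk
    rcases ENNReal.add_eq_top.1 (top_le_iff.1 hsum) with h | h
    · exact absurd h (ENNReal.add_lt_top.2 ⟨h4, h5⟩).ne
    · exact h
  rw [lintegral_congr_ae hae, lintegral_const, circ_univ]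
  exact ENNReal.top_mul (by simp [Real.pi_pos])

variable [Fintype K]

theorem posTrace_eq_sum (X : Ell K →L[ℂ] Ell K) :
    posTrace X = ∑ k, ENNReal.ofReal (inner ℂ (stdBasis K k) (X (stdBasis K k))).re := by
  simp only [posTrace, tsum_fintype, stdBasis_apply]

/-- For finite `K` the operator is a finite combination of fixed rank one operators with measurable
coefficients. -/
theorem IsSpectralDensity.aestronglyMeasurable {n : ℕ} {F : OpFamily K}
    (hF : IsSpectralDensity n F) (m : ℕ) : AEStronglyMeasurable (F m) circ := by
  have heq : F m = fun s => ∑ k, ∑ k', (inner ℂ (basisVec k') (F m s (basisVec k))) •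
      ((innerSL ℂ (stdBasis K k)).smulRight (stdBasis K k')) := by
    funext s
    ext1 x
    conv_lhs => rw [← (stdBasis K).sum_repr' x, map_sum]
    rw [sum_apply]
    refine Finset.sum_congr rfl fun k _ => ?_
    rw [map_smul, sum_apply]
    conv_lhs => rw [← (stdBasis K).sum_repr' (F m s (stdBasis K k)), Finset.smul_sum]
    refine Finset.sum_congr rfl fun k' _ => ?_
    simp only [smul_apply, ContinuousLinearMap.smulRight_apply,
      innerSL_apply_apply, stdBasis_apply]
    exact smul_comm _ _ _
  rw [heq]
  exact Finset.aestronglyMeasurable_fun_sum _ fun k _ =>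
    Finset.aestronglyMeasurable_fun_sum _ fun k' _ => (hF.measurable_entries m k k').smul_const _

theorem Minimality.exists_isDensityPair {n : ℕ} {F G : OpFamily K}
    (hF : IsSpectralDensity n F) (hG : IsSpectralDensity n G) (hmin : Minimality F G) (m : ℕ) :
    ∃ T S, IsDensityPair (F m) (G m) T S := by
  have : FiniteDimensional ℂ (Ell K) := finiteDimensional_ell
  refine Extrapolation.exists_isDensityPair (stdBasis K) (hF.aestronglyMeasurable m)
    (hG.aestronglyMeasurable m) (hF.positive m) (hG.positive m) (hmin m).1 ?_ ?_
  · refine ne_top_of_le_ne_top (ENNReal.add_ne_top.2 ⟨hF.trace_integrable m, hG.trace_integrable m⟩) ?_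
    rw [← lintegral_add_left' (aemeasurable_posTrace hF m)]
    refine lintegral_mono fun s => ?_
    simp only [posTrace_eq_sum, ← Finset.sum_add_distrib]
    refine Finset.sum_le_sum fun k _ => ?_
    rw [add_apply, inner_add_right, Complex.add_re]
    exact ENNReal.ofReal_add_le
  · simpa only [posTrace_eq_sum] using (hmin m).2

end

/-! ### From the components to the field -/

theorem memLp_two_of_lintegral_ne_top {E : Type*} [NormedAddCommGroup E] {f : ℝ → E}
    (hf : AEStronglyMeasurable f circ) (h : ∫⁻ s, ENNReal.ofReal (‖f s‖ ^ 2) ∂circ ≠ ⊤) :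
    MemLp f 2 circ := by
  refine memLp_two_of_integrable_sq_norm hf ⟨hf.norm.pow 2, ?_⟩
  rw [hasFiniteIntegral_iff_ofReal (Eventually.of_forall fun s => sq_nonneg _)]
  exact lt_top_iff_ne_top.2 h

theorem IsDensityPair.lintegral_inner_add_eq {E : Type*} [NormedAddCommGroup E]
    [InnerProductSpace ℂ E] {F G T S : ℝ → E →L[ℂ] E} (h : IsDensityPair F G T S) (y : ℝ → E) :
    ∫⁻ s, ENNReal.ofReal (inner ℂ (y s) ((F s + G s) (y s))).re ∂circ
      = ∫⁻ s, ENNReal.ofReal (‖T s (y s)‖ ^ 2) ∂circ := by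
  refine lintegral_congr_ae ?_
  filter_upwards [h.symm, h.mul_self] with s h1 h2
  rw [← h2, ← inner_self_eq_norm_sq (𝕜 := ℂ), h1]
  rfl

/-- The span of the functions `T e^{ijs} b_k`, `j < 0`, whose closure is the past. -/
noncomputable def pastSpan {E : Type*} [NormedAddCommGroup E] [InnerProductSpace ℂ E] {ι : Type*}
    {T : ℝ → E →L[ℂ] E} (hT : MemLp T 2 circ) (b : ι → E) : Submodule ℂ (Lp E 2 circ) :=
  Submodule.span ℂ {f | ∃ (j : ℤ) (k : ι), j < 0 ∧ f = (memLp_apply_trig hT j (b k)).toLp _}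

section

variable {n : ℕ} {K : Type*} {F G : OpFamily K} {T S : ℕ → ℝ → (Ell K →L[ℂ] Ell K)}

theorem sqNorm_add_eq (h : ∀ m, IsDensityPair (F m) (G m) (T m) (S m))
    (y : HIndex n → ℝ → Ell K) :
    sqNorm (F + G) y = ∑' i : HIndex n, ∫⁻ s, ENNReal.ofReal (‖T i.1 s (y i s)‖ ^ 2) ∂circ :=
  tsum_congr fun i => (h i.1).lintegral_inner_add_eq (y i)

theorem IsAdmissibleCoeff.summable_component {a : HIndex n → ℕ → Ell K}
    (ha : IsAdmissibleCoeff a) (i : HIndex n) : Summable fun j => ‖a i j‖ :=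
  ha.summable_norm.prod_factor i

theorem memLp_of_mem_L2 (h : ∀ m, IsDensityPair (F m) (G m) (T m) (S m))
    {y : HIndex n → ℝ → Ell K} (hy : y ∈ L2 n (F + G)) (i : HIndex n) :
    MemLp (fun s => T i.1 s (y i s)) 2 circ := by
  refine memLp_two_of_lintegral_ne_top (aestronglyMeasurable_apply (h i.1).memLp.1 (hy.1 i)) ?_
  have := hy.2
  rw [sqNorm_add_eq h] at this
  exact ENNReal.ne_top_of_tsum_ne_top this i

theorem norm_symbolA_le {a : HIndex n → ℕ → Ell K} (ha : IsAdmissibleCoeff a) (i : HIndex n)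
    (s : ℝ) : ‖symbolA a i s‖ ≤ ∑' j, ‖a i j‖ := by
  rw [symbolA_eq]
  exact norm_tsum_trig_le (ha.summable_component i) s

theorem aestronglyMeasurable_symbolA {a : HIndex n → ℕ → Ell K} (ha : IsAdmissibleCoeff a)
    (i : HIndex n) : AEStronglyMeasurable (symbolA a i) circ := by
  rw [show symbolA a i = _ from funext (symbolA_eq a i)]
  exact (continuous_tsum_trig (ha.summable_component i)).aestronglyMeasurable

variable [Fintype K]

theorem trig_stdBasis (j : ℤ) (k : K) :
    (fun s : ℝ => Complex.exp (Complex.I * (j : ℂ) * (s : ℂ)) • (basisVec k : Ell K))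
      = trig j (stdBasis K k) := by
  funext s
  rw [trig, expo, stdBasis_apply]

/-- With the converse for a single component below, this identifies `L2neg` for F + G, componentwise
through multiplication by T, with the past spaces. -/
theorem exists_mem_pastSpan_of_mem_negPoly {T : ℝ → (Ell K →L[ℂ] Ell K)} (hT : MemLp T 2 circ)
    (i : HIndex n) {p : HIndex n → ℝ → Ell K} (hp : p ∈ negPoly n K) :
    ∃ g ∈ pastSpan hT (stdBasis K), (g : ℝ → Ell K) =ᵐ[circ] fun s => T s (p i s) := by
  classical
  induction hp using Submodule.span_induction with
  | mem q hq =>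
    obtain ⟨i', j, k, hj, rfl⟩ := hq
    by_cases hi : i = i'
    · subst hi
      refine ⟨_, Submodule.subset_span ⟨j, k, hj, rfl⟩, ?_⟩
      filter_upwards [(memLp_apply_trig hT j (stdBasis K k)).coeFn_toLp] with s hs
      rw [hs, Pi.single_eq_same, ← trig_stdBasis]
    · refine ⟨0, Submodule.zero_mem _, ?_⟩
      filter_upwards [Lp.coeFn_zero (Ell K) 2 circ] with s hs
      rw [hs, Pi.single_eq_of_ne hi, Pi.zero_apply, map_zero]
  | zero =>
    refine ⟨0, Submodule.zero_mem _, ?_⟩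
    filter_upwards [Lp.coeFn_zero (Ell K) 2 circ] with s hs
    rw [hs, Pi.zero_apply, Pi.zero_apply, Pi.zero_apply, map_zero]
  | add p q _ _ hp hq =>
    obtain ⟨g, hg, hgp⟩ := hp
    obtain ⟨g', hg', hgq⟩ := hq
    refine ⟨g + g', Submodule.add_mem _ hg hg', ?_⟩
    filter_upwards [Lp.coeFn_add g g', hgp, hgq] with s h1 h2 h3
    rw [h1, Pi.add_apply, h2, h3, Pi.add_apply, Pi.add_apply, map_add]
  | smul c p _ hp =>
    obtain ⟨g, hg, hgp⟩ := hp
    refine ⟨c • g, Submodule.smul_mem _ c hg, ?_⟩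
    filter_upwards [Lp.coeFn_smul c g, hgp] with s h1 h2
    rw [h1, Pi.smul_apply, h2, Pi.smul_apply, Pi.smul_apply, map_smul]

open Classical in
theorem exists_negPoly_of_mem_pastSpan {T : ℝ → (Ell K →L[ℂ] Ell K)} (hT : MemLp T 2 circ)
    (i : HIndex n) {g : Lp (Ell K) 2 circ} (hg : g ∈ pastSpan hT (stdBasis K)) :
    ∃ q : ℝ → Ell K, Pi.single i q ∈ negPoly n K ∧
      (g : ℝ → Ell K) =ᵐ[circ] fun s => T s (q s) := by
  induction hg using Submodule.span_induction with
  | mem f hf =>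
    obtain ⟨j, k, hj, rfl⟩ := hf
    refine ⟨trig j (stdBasis K k), Submodule.subset_span ⟨i, j, k, hj, ?_⟩, ?_⟩
    · rw [trig_stdBasis]
    · exact (memLp_apply_trig hT j (stdBasis K k)).coeFn_toLp
  | zero =>
    refine ⟨0, by rw [Pi.single_zero]; exact Submodule.zero_mem _, ?_⟩
    filter_upwards [Lp.coeFn_zero (Ell K) 2 circ] with s hs
    rw [hs, Pi.zero_apply, map_zero]
  | add f g _ _ hf hg =>
    obtain ⟨p, hp, hpf⟩ := hf
    obtain ⟨q, hq, hqg⟩ := hg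
    refine ⟨p + q, by rw [Pi.single_add]; exact Submodule.add_mem _ hp hq, ?_⟩
    filter_upwards [Lp.coeFn_add f g, hpf, hqg] with s h1 h2 h3
    rw [h1, Pi.add_apply, h2, h3, Pi.add_apply, map_add]
  | smul c f _ hf =>
    obtain ⟨p, hp, hpf⟩ := hf
    refine ⟨c • p, by rw [Pi.single_smul]; exact Submodule.smul_mem _ c hp, ?_⟩
    filter_upwards [Lp.coeFn_smul c f, hpf] with s h1 h2
    rw [h1, Pi.smul_apply, h2, Pi.smul_apply, map_smul]

theorem toLp_mem_pastSpace (h : ∀ m, IsDensityPair (F m) (G m) (T m) (S m))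
    {y : HIndex n → ℝ → Ell K} (hy : y ∈ L2neg n (F + G)) (i : HIndex n) :
    (memLp_of_mem_L2 h hy.1 i).toLp _ ∈ pastSpace (h i.1).memLp (stdBasis K) := by
  have hyL := memLp_of_mem_L2 h hy.1 i
  change hyL.toLp _ ∈ closure (pastSpan (h i.1).memLp (stdBasis K) : Set (Lp (Ell K) 2 circ))
  rw [Metric.mem_closure_iff]
  intro ε hε
  obtain ⟨p, hp, hpε⟩ := hy.2 (ENNReal.ofReal (ε ^ 2)) (by positivity)
  obtain ⟨g, hg, hgp⟩ := exists_mem_pastSpan_of_mem_negPoly (h i.1).memLp i hp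
  refine ⟨g, hg, ?_⟩
  rw [sqNorm_add_eq h] at hpε
  have h1 := (ENNReal.le_tsum i).trans_lt hpε
  have h2 : ∫⁻ s, ENNReal.ofReal (‖T i.1 s ((y - p) i s)‖ ^ 2) ∂circ
      = ENNReal.ofReal (‖hyL.toLp _ - g‖ ^ 2) := by
    rw [← lintegral_norm_sq_eq]
    refine lintegral_congr_ae ?_
    filter_upwards [hyL.coeFn_toLp, hgp, Lp.coeFn_sub (hyL.toLp _) g] with s h1 h2 h3
    rw [h3]
    simp only [Pi.sub_apply, map_sub]
    rw [h1, h2]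
  rw [h2, ENNReal.ofReal_lt_ofReal_iff (by positivity)] at h1
  rw [dist_eq_norm]
  exact lt_of_pow_lt_pow_left₀ 2 hε.le h1

/-- Only finitely many components need approximation: the finite norm makes the tail of the others
small, and there the approximant is zero. -/
theorem mem_L2neg_of_components (h : ∀ m, IsDensityPair (F m) (G m) (T m) (S m))
    {y : HIndex n → ℝ → Ell K} (hy : y ∈ L2 n (F + G))
    (hpast : ∀ i, (memLp_of_mem_L2 h hy i).toLp _ ∈ pastSpace (h i.1).memLp (stdBasis K)) :
    y ∈ L2neg n (F + G) := by
  classical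
  refine ⟨hy, fun ε hε => ?_⟩
  set c : HIndex n → ℝ≥0∞ := fun i => ∫⁻ s, ENNReal.ofReal (‖T i.1 s (y i s)‖ ^ 2) ∂circ with hc
  have hcsum : ∑' i, c i ≠ ⊤ := by
    rw [← sqNorm_add_eq h]
    exact hy.2
  obtain ⟨t, ht⟩ := ((ENNReal.tendsto_tsum_compl_atTop_zero hcsum).eventually
    (gt_mem_nhds (ENNReal.half_pos hε.ne'))).exists
  -- Half of `ε` is spent on the tail outside `t`, the other half on the components in `t`, each
  -- costing at most δ².
  obtain ⟨δ, hδ, hδε⟩ : ∃ δ : ℝ, 0 < δ ∧ (t.card : ℝ≥0∞) * ENNReal.ofReal (δ ^ 2) < ε / 2 := by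
    have hcont : Tendsto (fun δ : ℝ => (t.card : ℝ≥0∞) * ENNReal.ofReal (δ ^ 2)) (𝓝[>] 0) (𝓝 0) := by
      have h1 : Tendsto (fun δ : ℝ => ENNReal.ofReal (δ ^ 2)) (𝓝[>] 0) (𝓝 0) := by
        have h2 : Continuous fun δ : ℝ => ENNReal.ofReal (δ ^ 2) :=
          ENNReal.continuous_ofReal.comp (continuous_pow 2)
        have h3 := h2.tendsto 0
        simp only [ne_eq, OfNat.ofNat_ne_zero, not_false_eq_true, zero_pow,
          ENNReal.ofReal_zero] at h3
        exact h3.mono_left nhdsWithin_le_nhds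
      have h4 := ENNReal.Tendsto.const_mul (a := (t.card : ℝ≥0∞)) h1
        (Or.inr (ENNReal.natCast_ne_top _))
      rwa [mul_zero] at h4
    obtain ⟨δ, h1, h2⟩ := ((hcont.eventually (gt_mem_nhds (ENNReal.half_pos hε.ne'))).and
      self_mem_nhdsWithin).exists
    exact ⟨δ, h2, h1⟩
  have happrox : ∀ i, ∃ q : ℝ → Ell K, Pi.single i q ∈ negPoly n K ∧
      ∫⁻ s, ENNReal.ofReal (‖T i.1 s (y i s - q s)‖ ^ 2) ∂circ ≤ ENNReal.ofReal (δ ^ 2) := by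
    intro i
    have hyL := memLp_of_mem_L2 h hy i
    have hcl : hyL.toLp _ ∈ closure (pastSpan (h i.1).memLp (stdBasis K) : Set (Lp (Ell K) 2 circ)) :=
      hpast i
    obtain ⟨g, hg, hdist⟩ := Metric.mem_closure_iff.1 hcl δ hδ
    obtain ⟨q, hq, hgq⟩ := exists_negPoly_of_mem_pastSpan (h i.1).memLp i hg
    refine ⟨q, hq, ?_⟩
    have h2 : ∫⁻ s, ENNReal.ofReal (‖T i.1 s (y i s - q s)‖ ^ 2) ∂circ
        = ENNReal.ofReal (‖hyL.toLp _ - g‖ ^ 2) := by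
      rw [← lintegral_norm_sq_eq]
      refine lintegral_congr_ae ?_
      filter_upwards [hyL.coeFn_toLp, hgq, Lp.coeFn_sub (hyL.toLp _) g] with s h1 h2 h3
      rw [h3, Pi.sub_apply, h1, h2, map_sub]
    rw [h2]
    rw [dist_eq_norm] at hdist
    exact ENNReal.ofReal_le_ofReal (by gcongr)
  choose q hq hqδ using happrox
  refine ⟨∑ i ∈ t, Pi.single i (q i), Submodule.sum_mem _ fun i _ => hq i, ?_⟩
  rw [sqNorm_add_eq h]
  have hpt : ∀ i : HIndex n, (∑ i' ∈ t, Pi.single i' (q i') : HIndex n → ℝ → Ell K) i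
      = if i ∈ t then q i else 0 := fun i => by
    rw [Finset.sum_apply, Finset.sum_pi_single]
  have hle : ∀ i : HIndex n, ∫⁻ s, ENNReal.ofReal
      (‖T i.1 s ((y - ∑ i' ∈ t, Pi.single i' (q i')) i s)‖ ^ 2) ∂circ
      ≤ (if i ∈ t then ENNReal.ofReal (δ ^ 2) else 0) + ({i | i ∉ t} : Set (HIndex n)).indicator c i := by
    intro i
    rw [Pi.sub_apply, hpt]
    by_cases hi : i ∈ t
    · rw [if_pos hi, if_pos hi]
      exact (hqδ i).trans le_self_add
    · rw [if_neg hi, if_neg hi, sub_zero, zero_add, Set.indicator_of_mem (by exact hi)]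
  refine (ENNReal.tsum_le_tsum hle).trans_lt ?_
  rw [ENNReal.tsum_add, ← tsum_subtype, tsum_eq_sum (s := t) fun i hi => if_neg hi,
    Finset.sum_congr rfl fun i hi => if_pos hi, Finset.sum_const, nsmul_eq_mul,
    ← ENNReal.add_halves ε]
  exact ENNReal.add_lt_add hδε ht

/-! ### The minimal error -/

/-- ‖A_m^l‖ is at most the sum `C` of the coefficient norms, and `C` is square summable because it
is summable. This power bounds the norm of the optimal characteristic, placing it in `L2`. -/
theorem tsum_signal_power_ne_top {a : HIndex n → ℕ → Ell K} (ha : IsAdmissibleCoeff a)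
    (hF : IsSpectralDensity n F) :
    ∑' i : HIndex n, ∫⁻ s, ENNReal.ofReal
      (inner ℂ (symbolA a i s) (F i.1 s (symbolA a i s))).re ∂circ ≠ ⊤ := by
  set C : HIndex n → ℝ := fun i => ∑' j, ‖a i j‖ with hC
  have hC0 : ∀ i, 0 ≤ C i := fun i => tsum_nonneg fun j => norm_nonneg _
  have hCs : Summable C := ha.summable_norm.prod
  have hCsq : Summable fun i => C i ^ 2 := by
    refine (hCs.mul_left (∑' i, C i)).of_nonneg_of_le (fun i => sq_nonneg _) fun i => ?_
    rw [sq]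
    exact mul_le_mul_of_nonneg_right (hCs.le_tsum i fun j _ => hC0 j) (hC0 i)
  set τ : ℝ≥0∞ := ∑' m : ℕ, (harmonicCount m n : ℝ≥0∞) * ∫⁻ s, posTrace (F m s) ∂circ with hτ
  have hle : ∀ i : HIndex n, ∫⁻ s, ENNReal.ofReal
      (inner ℂ (symbolA a i s) (F i.1 s (symbolA a i s))).re ∂circ
      ≤ ENNReal.ofReal (C i ^ 2) * τ := fun i => by
    have h1 : ∫⁻ s, posTrace (F i.1 s) ∂circ ≤ τ := by
      -- The multiplicity is nonzero because the index `i` itself carries an element of `Fin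
      -- (harmonicCount i.1 n)`.
      have hcount : (1 : ℝ≥0∞) ≤ (harmonicCount i.1 n : ℝ≥0∞) := by
        have : 1 ≤ harmonicCount i.1 n := Nat.one_le_iff_ne_zero.2 fun h0 =>
          (Fin.cast h0 i.2).elim0
        exact_mod_cast this
      refine (le_mul_of_one_le_left zero_le hcount).trans ?_
      exact ENNReal.le_tsum (f := fun m : ℕ => (harmonicCount m n : ℝ≥0∞) *
        ∫⁻ s, posTrace (F m s) ∂circ) i.1
    refine le_trans ?_ (mul_le_mul_right h1 _)
    rw [← lintegral_const_mul' _ _ ENNReal.ofReal_ne_top]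
    refine lintegral_mono_ae ?_
    filter_upwards [hF.positive i.1] with s hs
    have h2 := re_inner_le_trace (stdBasis K) hs (norm_symbolA_le ha i s)
    rw [posTrace_eq_sum, ← ENNReal.ofReal_sum_of_nonneg
      (f := fun k => (inner ℂ (stdBasis K k) (F i.1 s (stdBasis K k))).re)
      fun k _ => hs.re_inner_nonneg_right _, ← ENNReal.ofReal_mul (sq_nonneg _)]
    exact ENNReal.ofReal_le_ofReal h2
  refine ne_top_of_le_ne_top ?_ (ENNReal.tsum_le_tsum hle)
  rw [ENNReal.tsum_mul_right]
  exact ENNReal.mul_ne_top hCsq.tsum_ofReal_ne_top hF.total_power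

/-- Under the minimality condition the objective functional is the minimal mean square error, and
the minimum is attained. -/
theorem exists_optimal {a : HIndex n → ℕ → Ell K} (ha : IsAdmissibleCoeff a)
    (hF : IsSpectralDensity n F) (hG : IsSpectralDensity n G) (hmin : Minimality F G) :
    (∃ y ∈ L2neg n (F + G), mse a y F G = objective a F G) ∧
      ∀ y ∈ L2neg n (F + G), objective a F G ≤ mse a y F G := by
  choose T S h using hmin.exists_isDensityPair hF hG
  have hU := fun i : HIndex n => (h i.1).memLp_response (aestronglyMeasurable_symbolA ha i)
    (norm_symbolA_le ha i)
  have hmse : ∀ (y : HIndex n → ℝ → Ell K), mse a y F G = ∑' i : HIndex n,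
      (ENNReal.ofReal (1 / (2 * Real.pi)) * (∫⁻ s, ENNReal.ofReal
        (‖T i.1 s (y i s) - S i.1 s (F i.1 s (symbolA a i s))‖ ^ 2) ∂circ)
        + ENNReal.ofReal (pairing (vecA a i) (matAct (matR F G i.1) (vecA a i))).re) := fun y => by
    refine tsum_congr fun i => ?_
    rw [(h i.1).lintegral_error (aestronglyMeasurable_symbolA ha i) (y i), mul_add,
      (h i.1).residual_eq_pairing (ha.summable_component i)]
  have hobj : objective a F G = ∑' i : HIndex n,
      (ENNReal.ofReal (1 / (2 * Real.pi)) * ENNReal.ofReal (‖(hU i).toLp _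
        - (pastSpace (h i.1).memLp (stdBasis K)).starProjection ((hU i).toLp _)‖ ^ 2)
        + ENNReal.ofReal (pairing (vecA a i) (matAct (matR F G i.1) (vecA a i))).re) :=
    tsum_congr fun i => by
      rw [(h i.1).dist_eq_invForm (ha.summable_component i) (hU i), add_comm]
  constructor
  -- Both the error and the objective split over components, so the optimal components assemble into
  -- an optimal characteristic once the total norm is finite.
  · choose y hym hy hyN hybd hydist using fun i : HIndex n =>
      (h i.1).exists_lintegral_dist_eq (stdBasis K) (aestronglyMeasurable_symbolA ha i)
        (norm_symbolA_le ha i)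
    have hyL2 : y ∈ L2 n (F + G) := by
      refine ⟨hym, ?_⟩
      rw [sqNorm_add_eq h]
      exact ne_top_of_le_ne_top (tsum_signal_power_ne_top ha hF) (ENNReal.tsum_le_tsum hybd)
    refine ⟨y, mem_L2neg_of_components h hyL2 hyN, ?_⟩
    rw [hmse, hobj]
    exact tsum_congr fun i => by rw [hydist i]
  · intro y hy
    rw [hmse, hobj]
    refine ENNReal.tsum_le_tsum fun i => ?_
    gcongr
    exact (h i.1).le_lintegral_dist (stdBasis K) (aestronglyMeasurable_symbolA ha i)
      (norm_symbolA_le ha i) (memLp_of_mem_L2 h hy.1 i) (toLp_mem_pastSpace h hy i)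

theorem optMse_eq_objective {a : HIndex n → ℕ → Ell K} (ha : IsAdmissibleCoeff a)
    (hF : IsSpectralDensity n F) (hG : IsSpectralDensity n G) (hmin : Minimality F G) :
    optMse a F G = objective a F G := by
  obtain ⟨⟨y, hy, hye⟩, hle⟩ := exists_optimal ha hF hG hmin
  exact le_antisymm ((iInf₂_le y hy).trans hye.le) (le_iInf₂ hle)

end

/-! ### Pairs without the minimality condition -/

/-- The mixture dominates (1 - t) Q, which is strictly positive, and inversion reverses order on
strictly positive operators. -/
theorem isUnit_and_re_inner_inverse_le {E : Type*} [NormedAddCommGroup E] [InnerProductSpace ℂ E]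
    [CompleteSpace E] {P Q : E →L[ℂ] E} (hP : P.IsPositive) (hQ : Q.IsPositive) (hu : IsUnit Q)
    {t : ℝ} (ht0 : 0 ≤ t) (ht1 : t < 1) :
    IsUnit ((t : ℂ) • P + ((1 - t : ℝ) : ℂ) • Q) ∧ ∀ e : E,
      (inner ℂ e (Ring.inverse ((t : ℂ) • P + ((1 - t : ℝ) : ℂ) • Q) e)).re
        ≤ (1 - t)⁻¹ * (inner ℂ e (Ring.inverse Q e)).re := by
  have hr : 0 < 1 - t := sub_pos.2 ht1
  have hrc : ((1 - t : ℝ) : ℂ) ≠ 0 := by exact_mod_cast hr.ne'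
  have hQ' : (((1 - t : ℝ) : ℂ) • Q).IsPositive := hQ.smul_of_nonneg (by exact_mod_cast hr.le)
  have hP' : ((t : ℂ) • P).IsPositive := hP.smul_of_nonneg (by exact_mod_cast ht0)
  have hu' : IsUnit (((1 - t : ℝ) : ℂ) • Q) := hu.smul (Units.mk0 _ hrc)
  have hpos : IsStrictlyPositive (((1 - t : ℝ) : ℂ) • Q) :=
    ⟨(ContinuousLinearMap.nonneg_iff_isPositive _).2 hQ', hu'⟩
  have hle : ((1 - t : ℝ) : ℂ) • Q ≤ (t : ℂ) • P + ((1 - t : ℝ) : ℂ) • Q :=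
    le_add_of_nonneg_left ((ContinuousLinearMap.nonneg_iff_isPositive _).2 hP')
  refine ⟨(hpos.of_le hle).isUnit, fun e => ?_⟩
  have hinv : Ring.inverse (((1 - t : ℝ) : ℂ) • Q) = (((1 - t)⁻¹ : ℝ) : ℂ) • Ring.inverse Q := by
    rw [← Ring.inverse_mul_cancel_left _ ((((1 - t)⁻¹ : ℝ) : ℂ) • Ring.inverse Q) hu',
      smul_mul_smul_comm, Ring.mul_inverse_cancel _ hu, ← Complex.ofReal_mul,
      mul_inv_cancel₀ hr.ne', Complex.ofReal_one, one_smul, mul_one]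
  have h := CStarAlgebra.ringInverse_le_ringInverse hle hpos
  have h1 := (ContinuousLinearMap.le_def _ _).1 h |>.re_inner_nonneg_right e
  rw [hinv, sub_apply, inner_sub_right, smul_apply,
    inner_smul_right, map_sub, RCLike.re_to_complex, RCLike.re_to_complex, Complex.re_ofReal_mul] at h1
  linarith

section

variable {n : ℕ} {K : Type*}

theorem real_smul_eq (r : ℝ) (X : Ell K →L[ℂ] Ell K) : r • X = (r : ℂ) • X := by
  refine ContinuousLinearMap.ext fun v => ?_
  exact (Complex.coe_smul r (X v)).symm

theorem mul_re_inner_le_mix {X Y : Ell K →L[ℂ] Ell K} (hY : Y.IsPositive) {t : ℝ} (ht : t ≤ 1)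
    (v : Ell K) :
    t * (inner ℂ v (X v)).re ≤ (inner ℂ v ((t • X + (1 - t) • Y) v)).re := by
  rw [real_smul_eq, real_smul_eq, add_apply, smul_apply,
    smul_apply, inner_add_right, inner_smul_right, inner_smul_right,
    Complex.add_re, Complex.re_ofReal_mul, Complex.re_ofReal_mul]
  have h := mul_nonneg (sub_nonneg.2 ht) (hY.re_inner_nonneg_right v)
  rw [RCLike.re_to_complex] at h
  linarith

variable {F G F₀ G₀ : OpFamily K} {t : ℝ}

theorem mul_ofReal_re_inner_le_mix (hP : ∀ m, ∀ᵐ s ∂circ, (F₀ m s).IsPositive) (ht0 : 0 ≤ t) (ht1 : t ≤ 1)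
    (m : ℕ) : ∀ᵐ s ∂circ, ∀ v : Ell K, ENNReal.ofReal t * ENNReal.ofReal (inner ℂ v (F m s v)).re
      ≤ ENNReal.ofReal (inner ℂ v ((t • F + (1 - t) • F₀) m s v)).re := by
  filter_upwards [hP m] with s hs v
  rw [← ENNReal.ofReal_mul ht0]
  exact ENNReal.ofReal_le_ofReal (mul_re_inner_le_mix hs ht1 v)

theorem mul_sqNorm_le_mix (hP : ∀ m, ∀ᵐ s ∂circ, (F₀ m s).IsPositive) (ht0 : 0 ≤ t) (ht1 : t ≤ 1)
    (y : HIndex n → ℝ → Ell K) :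
    ENNReal.ofReal t * sqNorm F y ≤ sqNorm (t • F + (1 - t) • F₀) y := by
  rw [sqNorm, sqNorm, ← ENNReal.tsum_mul_left]
  refine ENNReal.tsum_le_tsum fun i => ?_
  rw [← lintegral_const_mul' _ _ ENNReal.ofReal_ne_top]
  refine lintegral_mono_ae ?_
  filter_upwards [mul_ofReal_re_inner_le_mix hP ht0 ht1 i.1] with s hs
  exact hs _

theorem mul_mse_le_mix (hF₀ : IsSpectralDensity n F₀) (hG₀ : IsSpectralDensity n G₀)
    (ht0 : 0 ≤ t) (ht1 : t ≤ 1) (a : HIndex n → ℕ → Ell K) (y : HIndex n → ℝ → Ell K) :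
    ENNReal.ofReal t * mse a y F G
      ≤ mse a y (t • F + (1 - t) • F₀) (t • G + (1 - t) • G₀) := by
  rw [mse, mse, ← ENNReal.tsum_mul_left]
  refine ENNReal.tsum_le_tsum fun i => ?_
  rw [mul_left_comm, ← lintegral_const_mul' _ _ ENNReal.ofReal_ne_top]
  refine mul_le_mul_right (lintegral_mono_ae ?_) _
  filter_upwards [mul_ofReal_re_inner_le_mix (F := F) hF₀.positive ht0 ht1 i.1,
    mul_ofReal_re_inner_le_mix (F := G) hG₀.positive ht0 ht1 i.1] with s h1 h2
  rw [mul_add]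
  exact add_le_add (h1 _) (h2 _)

/-- Since t F is dominated by the mixture, approximation in the seminorm of the mixture implies
approximation in that of `F`. -/
theorem L2neg_mix_subset (hP : ∀ m, ∀ᵐ s ∂circ, (F₀ m s).IsPositive) (ht0 : 0 < t) (ht1 : t ≤ 1) :
    L2neg n (t • F + (1 - t) • F₀) ⊆ L2neg n F := by
  have ht : ENNReal.ofReal t ≠ 0 := (ENNReal.ofReal_pos.2 ht0).ne'
  have hle := fun y : HIndex n → ℝ → Ell K => mul_sqNorm_le_mix (F := F) hP ht0.le ht1 y
  rintro y ⟨⟨hm, hy⟩, hap⟩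
  refine ⟨⟨hm, fun htop => hy ?_⟩, fun ε hε => ?_⟩
  · have := hle y
    rwa [htop, ENNReal.mul_top ht, top_le_iff] at this
  · obtain ⟨p, hp, hpε⟩ := hap (ENNReal.ofReal t * ε) (ENNReal.mul_pos ht hε.ne')
    exact ⟨p, hp, (ENNReal.mul_lt_mul_iff_right ht ENNReal.ofReal_ne_top).1 ((hle _).trans_lt hpε)⟩

theorem mix_add_mix : (t • F + (1 - t) • F₀) + (t • G + (1 - t) • G₀)
    = t • (F + G) + (1 - t) • (F₀ + G₀) := by
  rw [smul_add, smul_add]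
  abel

/-- A characteristic admissible for the mixture is admissible for (F, G), and its error there,
multiplied by t, is no larger. No minimality is required. -/
theorem mul_optMse_le_mix (hF₀ : IsSpectralDensity n F₀) (hG₀ : IsSpectralDensity n G₀)
    (ht0 : 0 < t) (ht1 : t ≤ 1) (a : HIndex n → ℕ → Ell K) :
    ENNReal.ofReal t * optMse a F G
      ≤ optMse a (t • F + (1 - t) • F₀) (t • G + (1 - t) • G₀) := by
  have hP : ∀ m, ∀ᵐ s ∂circ, ((F₀ + G₀) m s).IsPositive := fun m => by
    filter_upwards [hF₀.positive m, hG₀.positive m] with s h1 h2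
    exact h1.add h2
  refine le_iInf₂ fun y hy => ?_
  rw [mix_add_mix] at hy
  refine le_trans ?_ (mul_mse_le_mix hF₀ hG₀ ht0.le ht1 a y)
  exact mul_le_mul_right (iInf₂_le y (L2neg_mix_subset hP ht0 ht1 hy)) _

theorem Minimality.mix (hF : IsSpectralDensity n F) (hG : IsSpectralDensity n G)
    (hF₀ : IsSpectralDensity n F₀) (hG₀ : IsSpectralDensity n G₀) (hmin : Minimality F₀ G₀)
    (ht0 : 0 ≤ t) (ht1 : t < 1) :
    Minimality (t • F + (1 - t) • F₀) (t • G + (1 - t) • G₀) := by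
  intro m
  have key : ∀ᵐ s ∂circ, IsUnit ((t • F + (1 - t) • F₀) m s + (t • G + (1 - t) • G₀) m s) ∧
      posTrace (Ring.inverse ((t • F + (1 - t) • F₀) m s + (t • G + (1 - t) • G₀) m s))
        ≤ ENNReal.ofReal (1 - t)⁻¹ * posTrace (Ring.inverse (F₀ m s + G₀ m s)) := by
    filter_upwards [hF.positive m, hG.positive m, hF₀.positive m, hG₀.positive m, (hmin m).1]
      with s h1 h2 h3 h4 h5
    have heq : (t • F + (1 - t) • F₀) m s + (t • G + (1 - t) • G₀) m s
        = (t : ℂ) • (F m s + G m s) + ((1 - t : ℝ) : ℂ) • (F₀ m s + G₀ m s) := by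
      rw [← real_smul_eq, ← real_smul_eq]
      exact congrFun (congrFun (mix_add_mix (F := F) (G := G)) m) s
    obtain ⟨h6, h7⟩ := isUnit_and_re_inner_inverse_le (h1.add h2) (h3.add h4) h5 ht0 ht1
    rw [heq]
    refine ⟨h6, ?_⟩
    rw [posTrace, posTrace, ← ENNReal.tsum_mul_left]
    refine ENNReal.tsum_le_tsum fun k => ?_
    rw [← ENNReal.ofReal_mul (inv_nonneg.2 (sub_nonneg.2 ht1.le))]
    exact ENNReal.ofReal_le_ofReal (h7 _)
  refine ⟨key.mono fun s hs => hs.1, ?_⟩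
  refine ne_top_of_le_ne_top ?_ (lintegral_mono_ae (key.mono fun s hs => hs.2))
  rw [lintegral_const_mul' _ _ ENNReal.ofReal_ne_top]
  exact ENNReal.mul_ne_top ENNReal.ofReal_ne_top (hmin m).2

theorem le_of_forall_ofReal_mul_le {x y : ℝ≥0∞}
    (h : ∀ t : ℝ, 0 < t → t < 1 → ENNReal.ofReal t * x ≤ y) : x ≤ y := by
  have h1 : Tendsto (fun t : ℝ => ENNReal.ofReal t) (𝓝[<] 1) (𝓝 1) := by
    have := ENNReal.continuous_ofReal.tendsto 1
    rw [ENNReal.ofReal_one] at this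
    exact this.mono_left nhdsWithin_le_nhds
  have h2 := ENNReal.Tendsto.mul_const (b := x) h1 (Or.inl one_ne_zero)
  rw [one_mul] at h2
  refine le_of_tendsto h2 ?_
  filter_upwards [Ioo_mem_nhdsLT (zero_lt_one' ℝ)] with t ht
  exact h t ht.1 ht.2

end

end Extrapolation

/-! ### The least favorable pair -/

theorem lemma1 (n : ℕ) {K : Type*} [Countable K]
    (a : Extrapolation.HIndex n → ℕ → Extrapolation.Ell K)
    (ha : Extrapolation.IsAdmissibleCoeff a)
    (DF DG : Set (Extrapolation.OpFamily K))
    (hDF : ∀ F ∈ DF, Extrapolation.IsSpectralDensity n F)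
    (hDG : ∀ G ∈ DG, Extrapolation.IsSpectralDensity n G)
    (hD : (∀ F ∈ DF, ∀ G ∈ DG, Extrapolation.Minimality F G) ∨
      (Convex ℝ DF ∧ Convex ℝ DG))
    (F₀ G₀ : Extrapolation.OpFamily K) (hF₀ : F₀ ∈ DF) (hG₀ : G₀ ∈ DG)
    (hmin : Extrapolation.Minimality F₀ G₀)
    (hmax : (⨆ F ∈ DF, ⨆ G ∈ DG, ⨆ _ : Extrapolation.Minimality F G,
      Extrapolation.objective a F G) = Extrapolation.objective a F₀ G₀) :
    Extrapolation.IsLeastFavorable a DF DG F₀ G₀ := by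
  -- Finiteness of `K` follows from the single pair (F₀, G₀) and then serves every other pair.
  have := Extrapolation.finite_of_minimality (hDF F₀ hF₀) (hDG G₀ hG₀) hmin
  have := Fintype.ofFinite K
  have heq := Extrapolation.optMse_eq_objective ha (hDF F₀ hF₀) (hDG G₀ hG₀) hmin
  have hle : ∀ F ∈ DF, ∀ G ∈ DG, Extrapolation.Minimality F G →
      Extrapolation.optMse a F G ≤ Extrapolation.optMse a F₀ G₀ := by
    intro F hF G hG hm
    rw [heq, ← hmax, Extrapolation.optMse_eq_objective ha (hDF F hF) (hDG G hG) hm]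
    exact le_iSup₂_of_le F hF (le_iSup₂_of_le G hG (le_iSup_of_le hm le_rfl))
  refine ⟨hF₀, hG₀, ?_, fun F hF G hG => ?_⟩
  · obtain ⟨y, hy, hye⟩ := (Extrapolation.exists_optimal ha (hDF F₀ hF₀) (hDG G₀ hG₀) hmin).1
    exact ⟨y, hy, hye.trans heq.symm⟩
  · rcases hD with hall | ⟨hcF, hcG⟩
    · exact hle F hF G hG (hall F hF G hG)
    -- Here (F, G) may fail minimality. By convexity its mixtures with (F₀, G₀) stay in the classes,
    -- and for t < 1 they inherit minimality from (F₀, G₀).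
    · refine Extrapolation.le_of_forall_ofReal_mul_le fun t ht0 ht1 => ?_
      refine (Extrapolation.mul_optMse_le_mix (hDF F₀ hF₀) (hDG G₀ hG₀) ht0 ht1.le a).trans ?_
      exact hle _ (hcF hF hF₀ ht0.le (sub_nonneg.2 ht1.le) (add_sub_cancel t 1))
        _ (hcG hG hG₀ ht0.le (sub_nonneg.2 ht1.le) (add_sub_cancel t 1))
        (Extrapolation.Minimality.mix (hDF F hF) (hDG G hG) (hDF F₀ hF₀) (hDG G₀ hG₀) hmin
          ht0.le ht1)
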